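/- Let $\varepsilon,\tau>0$ and let $$K(x,y)=\exp\Big(-\tfrac12\varepsilon^2(x^2+y^2)+\tau^2\varepsilon^2xy\Big),\qquad x,y\in[-1,1],$$ be the analytic Hermite (Mehler) kernel. It is the weighted power series kernel $K(x,y)=\varphi(x)\varphi(y)\sum_{k=0}^\infty\alpha_k^{-1}x^ky^k$ with $\alpha_k=(\tau\varepsilon)^{-2k}k!$ and $\varphi(x)=e^{-\frac12\varepsilon^2x^2}$. Let $H(K)$, with norm $\|\cdot\|_K$, be its reproducing kernel Hilbert space, a space of real functions on $[-1,1]$. Consider linear approximations of the form $$A_nf=\sum_{k=1}^nf(x_k)\,\psi_k \qquad (\ast)$$ with pairwise distinct points $x_1,\dots,x_n\in[-1,1]$ and Lebesgue measurable functions $\psi_k\colon[-1,1]\to\mathbb R$. With $\|g\|_\infty=\sup_{x\in[-1,1]}|g(x)|\in[0,\infty]$, put $$e_\infty(A_n)=\sup_{0\ne f\in H(K)}\frac{\|f-A_nf\|_\infty}{\|f\|_K},\qquad e_\infty^{\min}(n)=\inf_{A_n}e_\infty(A_n),$$ where the infimum is over all approximations of the form $(\ast)$. For $\lambda>0$ let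 $$c_L(\lambda)=\frac{e^{-\frac32\lambda+2\sqrt\lambda}}{2\sqrt\pi\,\lambda^{1/4}}\Big(3+\sqrt{\tfrac{\pi}{e}}+\frac{2}{\sqrt\pi\,\lambda^{1/4}}+\frac{7}{16\sqrt\lambda}+\sqrt\lambda\,(2+\lambda)\Big),\qquad m_L(\lambda)=\max\Big\{5\lambda,\ \lambda\big(1+\tfrac\lambda2\big)^2,\ \frac9\lambda\Big\},$$ and set $$c_1=\sqrt{\frac{2}{1+\tau^2\varepsilon^2}}\;e^{-(\frac1{32}\tau^4\varepsilon^4+\frac12\varepsilon^2)},\qquad c_2=2\sqrt{c_L(\tau^2\varepsilon^2)}.$$ Then for every integer $n\ge m_L(\tau^2\varepsilon^2)$ $$c_1\Big(\frac{\tau\varepsilon}2\Big)^n(n!)^{-1/2}\le e_\infty^{\min}(n)\le c_2\,n^{-1/8}e^{\tau\varepsilon\sqrt n}\Big(\frac{\tau\varepsilon}2\Big)^n(n!)^{-1/2},$$ and for any pairwise distinct $x_1,\dots,x_n\in[-1,1]$ there is a linear approximation $A_n$ of the form $(\ast)$ that uses these points and satisfies $$c_1\Big(\frac{\tau\varepsilon}2\Big)^n(n!)^{-1/2}\le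 e_\infty(A_n)\le \frac{c_2}2\,n^{-1/8}e^{\tau\varepsilon\sqrt n}\,(2\tau\varepsilon)^n(n!)^{-1/2}.$$ -/

import Mathlib

open scoped ENNReal

noncomputable section

/-- The interval `[-1, 1]`. -/
abbrev SymInterval : Type := Set.Icc (-1 : ℝ) 1

/-- The weighted power series kernel `φ(x) φ(y) ∑ₖ αₖ⁻¹ xᵏ yᵏ` on `[-1, 1]`. -/
def weightedPowerSeriesKernel (α : ℕ → ℝ) (φ : SymInterval → ℝ) (x y : SymInterval) : ℝ :=
  φ x * φ y * ∑' k : ℕ, (α k)⁻¹ * (x : ℝ) ^ k * (y : ℝ) ^ k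

/-- The analytic Hermite (Mehler) kernel on `[-1, 1]`. -/
def analyticHermiteKernel (ε τ : ℝ) (x y : SymInterval) : ℝ :=
  Real.exp (-(1 / 2) * ε ^ 2 * ((x : ℝ) ^ 2 + (y : ℝ) ^ 2) + τ ^ 2 * ε ^ 2 * ((x : ℝ) * (y : ℝ)))

/-- The uniform norm `sup_{x ∈ [-1, 1]} |f x|`, with values in `[0, ∞]`. -/
def supNorm (f : SymInterval → ℝ) : ℝ≥0∞ := ⨆ x : SymInterval, ‖f x‖ₑ

/-- The data of a linear approximation `A f = ∑ₖ f(xₖ) ψₖ` that uses `n` function evaluations: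
pairwise distinct points `xₖ ∈ [-1, 1]` and Lebesgue measurable functions `ψₖ` on `[-1, 1]`. -/
structure LinearApprox (n : ℕ) where
  /-- the points `xₖ` -/
  node : Fin n → SymInterval
  node_injective : Function.Injective node
  /-- the functions `ψₖ` -/
  weight : Fin n → SymInterval → ℝ
  weight_measurable : ∀ k, MeasureTheory.NullMeasurable (weight k)
    (MeasureTheory.Measure.comap Subtype.val (MeasureTheory.volume : MeasureTheory.Measure ℝ))

/-- The function `A f = ∑ₖ f(xₖ) ψₖ`. -/
def LinearApprox.apply {n : ℕ} (A : LinearApprox n) (f : SymInterval → ℝ) : SymInterval → ℝ :=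
  fun x => ∑ k : Fin n, f (A.node k) * A.weight k x

section Errors

variable (H : Type*) [NormedAddCommGroup H] [InnerProductSpace ℝ H] [RKHS ℝ H SymInterval ℝ]

/-- The Hilbert space of functions `H` on `[-1, 1]` is the reproducing kernel Hilbert space of the
real-valued kernel `K`. Mathlib's kernel takes values in the linear maps `ℝ →L[ℝ] ℝ`, which are
identified with real numbers through their value at `1`. -/
def HasReproducingKernel [CompleteSpace H] (K : SymInterval → SymInterval → ℝ) : Prop :=
  ∀ x y : SymInterval, RKHS.kernel H x y 1 = K x y

/-- The worst-case error `e_∞(A) = sup_{0 ≠ f ∈ H} ‖f - A f‖_∞ / ‖f‖_H`. -/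
def worstCaseError {n : ℕ} (A : LinearApprox n) : ℝ≥0∞ :=
  ⨆ (f : H) (_ : f ≠ 0), supNorm (fun x => f x - A.apply (⇑f) x) / ‖f‖ₑ

/-- The `n`th minimal error `inf_A e_∞(A)`. -/
def minimalError (n : ℕ) : ℝ≥0∞ := ⨅ A : LinearApprox n, worstCaseError H A

end Errors

/-- The function `c_L`. -/
def cL (l : ℝ) : ℝ :=
  Real.exp (-(3 / 2) * l + 2 * √l) / (2 * √Real.pi * l ^ (1 / 4 : ℝ)) *
    (3 + √(Real.pi / Real.exp 1) + 2 / (√Real.pi * l ^ (1 / 4 : ℝ)) + 7 / (16 * √l)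
      + √l * (2 + l))

/-- The function `m_L`. -/
def mL (l : ℝ) : ℝ := max (5 * l) (max (l * (1 + l / 2) ^ 2) (9 / l))

/-- The constant `c₁` of the lower bounds. -/
def hermiteC1 (ε τ : ℝ) : ℝ :=
  √(2 / (1 + τ ^ 2 * ε ^ 2)) * Real.exp (-(1 / 32 * τ ^ 4 * ε ^ 4 + 1 / 2 * ε ^ 2))

/-- The constant `c₂` of the upper bounds. -/
def hermiteC2 (ε τ : ℝ) : ℝ := 2 * √(cL (τ ^ 2 * ε ^ 2))

end

/-!
The largest error of `A` at `x` on the unit ball of `H` is the norm of the residual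
`K(x, ·) - ∑ₖ ψₖ(x) K(xₖ, ·)`. For every centre `c` the Hermite kernel is
`w(x) w(y) ∑ₘ λᵐ / m! (x - c)ᵐ (y - c)ᵐ` with `λ = τ²ε²` and a positive weight `w`, so the squared
norm of the residual is the weighted sum of the squared errors of `A` at `x` on the functions
`w(t) (t - c)ᵐ`.

*Lower bound.* Take `c = 0` and let `p` be the monic polynomial of degree `n` that vanishes at the
nodes. Then `A` maps `w p` to zero, so by Cauchy-Schwarz the residual at `x` is at least
`w(x) |p(x)| / ‖p‖`, where `‖p‖² = ∑ₘ m! / λᵐ pₘ²`. By orthogonality of the Chebyshev polynomials,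
`‖p‖²` is at most `2 ‖p‖_∞² ∑ₖ ‖Tₖ‖²`, and the last sum is dominated by its top term.

*Upper bounds.* Lagrange interpolation weighted by `w` kills the first `n` terms of the residual,
and the others decay geometrically. For arbitrary nodes one uses `c = -x`, which moves with the
point of evaluation and gives `|x - t| + |t - c| ≤ 2` for every node `t`. Chebyshev nodes and
`c = 0` gain a factor `4⁻ⁿ` in the error, since there no Chebyshev polynomial has an interpolation
error above `2`.
-/

open Finset RKHS Polynomial

section KernelExpansion

variable {X H : Type*} [NormedAddCommGroup H] [InnerProductSpace ℝ H] [CompleteSpace H]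
  [RKHS ℝ H X ℝ] {ι : Type*} {a : ι → ℝ} {φ : ι → X → ℝ}

lemma hasSum_norm_sum_smul_kerFun_sq
    (hK : ∀ x y, HasSum (fun m => a m * (φ m x * φ m y)) (kernel H x y 1))
    {κ : Type*} [Fintype κ] (b : κ → ℝ) (y : κ → X) :
    HasSum (fun m => a m * (∑ i, b i * φ m (y i)) ^ 2) (‖∑ i, b i • kerFun H (y i) 1‖ ^ 2) := by
  have h : HasSum (fun m => ∑ i, ∑ j, b i * b j * (a m * (φ m (y j) * φ m (y i))))
      (∑ i, ∑ j, b i * b j * kernel H (y j) (y i) 1) :=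
    hasSum_sum fun i _ => hasSum_sum fun j _ => (hK (y j) (y i)).mul_left _
  convert h using 1
  · ext m
    rw [sq, Fintype.sum_mul_sum]
    simp only [mul_sum]
    exact sum_congr rfl fun i _ => sum_congr rfl fun j _ => by ring
  · rw [← real_inner_self_eq_norm_sq]
    simp only [sum_inner, inner_sum, real_inner_smul_left, real_inner_smul_right, kerFun_inner,
      kerFun_apply, RCLike.inner_apply, conj_trivial, mul_one, mul_assoc]

end KernelExpansion

namespace LinearApprox

variable {H : Type*} [NormedAddCommGroup H] [InnerProductSpace ℝ H] [RKHS ℝ H SymInterval ℝ]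
  [CompleteSpace H] {n : ℕ} (A : LinearApprox n)

variable (H) in
/-- The representer in `H` of the pointwise error functional `f ↦ f x - (A f) x`; its norm is the
largest error at `x` of `A` on the unit ball. -/
noncomputable def residual (x : SymInterval) : H :=
  kerFun H x 1 - ∑ k, A.weight k x • kerFun H (A.node k) 1

lemma inner_residual (x : SymInterval) (f : H) :
    inner ℝ (A.residual H x) f = f x - A.apply f x := by
  simp [residual, apply, inner_sub_left, sum_inner, real_inner_smul_left, kerFun_inner, mul_comm]

theorem worstCaseError_eq_iSup_enorm_residual :
    worstCaseError H A = ⨆ x, ‖A.residual H x‖ₑ := by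
  refine le_antisymm (iSup₂_le fun f _ => ENNReal.div_le_of_le_mul (iSup_le fun x => ?_))
    (iSup_le fun x => ?_)
  · calc ‖f x - A.apply f x‖ₑ = ‖inner ℝ (A.residual H x) f‖ₑ := by rw [inner_residual]
      _ ≤ ‖A.residual H x‖ₑ * ‖f‖ₑ := by
        simp only [← ofReal_norm, ← ENNReal.ofReal_mul (norm_nonneg _)]
        exact ENNReal.ofReal_le_ofReal (norm_inner_le_norm _ _)
      _ ≤ _ := by gcongr; exact le_iSup (fun x => ‖A.residual H x‖ₑ) x
  · rcases eq_or_ne (A.residual H x) 0 with h0 | h0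
    · simp [h0]
    refine le_iSup₂_of_le (A.residual H x) h0 ?_
    rw [ENNReal.le_div_iff_mul_le (by simp [h0]) (by simp)]
    calc ‖A.residual H x‖ₑ * ‖A.residual H x‖ₑ = ‖inner ℝ (A.residual H x) (A.residual H x)‖ₑ := by
          rw [real_inner_self_eq_norm_mul_norm, enorm_mul, enorm_norm]
      _ = ‖A.residual H x x - A.apply (A.residual H x) x‖ₑ := by rw [inner_residual]
      _ ≤ _ := le_iSup (fun y => ‖A.residual H x y - A.apply (A.residual H x) y‖ₑ) x

variable {ι : Type*} {a : ι → ℝ} {φ : ι → SymInterval → ℝ}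

lemma hasSum_norm_residual_sq
    (hK : ∀ x y, HasSum (fun m => a m * (φ m x * φ m y)) (kernel H x y 1)) (x : SymInterval) :
    HasSum (fun m => a m * (φ m x - ∑ k, A.weight k x * φ m (A.node k)) ^ 2)
      (‖A.residual H x‖ ^ 2) := by
  have h := hasSum_norm_sum_smul_kerFun_sq hK (κ := Option (Fin n))
    (fun i => i.elim 1 fun k => -A.weight k x) (fun i => i.elim x A.node)
  simpa [Fintype.sum_option, residual, sub_eq_add_neg] using h

lemma sq_sum_mul_le_mul_norm_residual_sq
    (hK : ∀ x y, HasSum (fun m => a m * (φ m x * φ m y)) (kernel H x y 1)) (ha : ∀ m, 0 < a m)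
    {s : Finset ι} {b : ι → ℝ} (hb : ∀ k, ∑ m ∈ s, b m * φ m (A.node k) = 0) (x : SymInterval) :
    (∑ m ∈ s, b m * φ m x) ^ 2 ≤ (∑ m ∈ s, b m ^ 2 / a m) * ‖A.residual H x‖ ^ 2 := by
  set d : ι → ℝ := fun m => φ m x - ∑ k, A.weight k x * φ m (A.node k)
  have hd : ∑ m ∈ s, b m * φ m x = ∑ m ∈ s, b m * d m := by
    simp only [d, mul_sub, sum_sub_distrib, mul_sum, mul_left_comm (b _)]
    rw [sum_comm]
    simp only [← mul_sum, hb, mul_zero, sum_const_zero, sub_zero]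
  have ha' : ∀ m, 0 ≤ a m * d m ^ 2 := fun m => mul_nonneg (ha m).le (sq_nonneg _)
  calc (∑ m ∈ s, b m * φ m x) ^ 2
      ≤ (∑ m ∈ s, b m ^ 2 / a m) * ∑ m ∈ s, a m * d m ^ 2 := by
        rw [hd]
        refine sum_sq_le_sum_mul_sum_of_sq_le_mul s
          (fun m _ => div_nonneg (sq_nonneg _) (ha m).le) (fun m _ => ha' m) fun m _ => ?_
        have := (ha m).ne'
        exact le_of_eq (by field_simp)
    _ ≤ _ := mul_le_mul_of_nonneg_left
        (sum_le_hasSum s (fun m _ => ha' m) (A.hasSum_norm_residual_sq hK x))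
        (sum_nonneg fun m _ => div_nonneg (sq_nonneg _) (ha m).le)

end LinearApprox

section HermiteKernel

variable {ε τ : ℝ}

/-- The Hermite kernel is `w(x) w(y) exp (τ²ε² (x - c) (y - c))` for every centre `c`, where
`w = hermiteWeight ε τ c`; the paper's `φ` is the weight with centre `0`. -/
noncomputable def hermiteWeight (ε τ c x : ℝ) : ℝ :=
  Real.exp (-(1 / 2) * ε ^ 2 * x ^ 2 + τ ^ 2 * ε ^ 2 * (c * x - c ^ 2 / 2))

lemma hasSum_analyticHermiteKernel (ε τ c : ℝ) (x y : SymInterval) :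
    HasSum (fun m : ℕ => (τ ^ 2 * ε ^ 2) ^ m / m.factorial *
        ((hermiteWeight ε τ c x * ((x : ℝ) - c) ^ m) *
          (hermiteWeight ε τ c y * ((y : ℝ) - c) ^ m)))
      (analyticHermiteKernel ε τ x y) := by
  have h := (NormedSpace.expSeries_div_hasSum_exp
    (τ ^ 2 * ε ^ 2 * (((x : ℝ) - c) * ((y : ℝ) - c)))).mul_left
      (hermiteWeight ε τ c x * hermiteWeight ε τ c y)
  have hprod : hermiteWeight ε τ c x * hermiteWeight ε τ c y *
      Real.exp (τ ^ 2 * ε ^ 2 * (((x : ℝ) - c) * ((y : ℝ) - c))) =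
        analyticHermiteKernel ε τ x y := by
    rw [hermiteWeight, hermiteWeight, ← Real.exp_add, ← Real.exp_add, analyticHermiteKernel]
    ring_nf
  rw [← Real.exp_eq_exp_ℝ, hprod] at h
  refine h.congr_fun fun m => ?_
  rw [mul_pow _ (_ * _) m, mul_pow ((x : ℝ) - c)]
  ring

lemma analyticHermiteKernel_eq_weightedPowerSeriesKernel (ε τ : ℝ) (x y : SymInterval) :
    analyticHermiteKernel ε τ x y =
      weightedPowerSeriesKernel (fun k => ((τ * ε) ^ (2 * k))⁻¹ * (k.factorial : ℝ))
        (fun x => Real.exp (-(1 / 2) * ε ^ 2 * (x : ℝ) ^ 2)) x y := by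
  rw [← (hasSum_analyticHermiteKernel ε τ 0 x y).tsum_eq, weightedPowerSeriesKernel,
    ← tsum_mul_left]
  refine tsum_congr fun m => ?_
  simp only [hermiteWeight, sub_zero, mul_inv, inv_inv, pow_mul]
  ring_nf

variable {H : Type*} [NormedAddCommGroup H] [InnerProductSpace ℝ H] [CompleteSpace H]
  [RKHS ℝ H SymInterval ℝ]

lemma HasReproducingKernel.hasSum_kernel
    (hH : HasReproducingKernel H (analyticHermiteKernel ε τ)) (c : ℝ) (x y : SymInterval) :
    HasSum (fun m : ℕ => (τ ^ 2 * ε ^ 2) ^ m / m.factorial *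
        ((hermiteWeight ε τ c x * ((x : ℝ) - c) ^ m) *
          (hermiteWeight ε τ c y * ((y : ℝ) - c) ^ m))) (kernel H x y 1) :=
  hH x y ▸ hasSum_analyticHermiteKernel ε τ c x y

end HermiteKernel

section InterpolationError

variable {F ι : Type*} [Field F] [DecidableEq ι] {s : Finset ι} {v : ι → F} {p : F[X]}

/-- The error `p - I p` of Lagrange interpolation of a polynomial at the points `v i`, `i ∈ s`. -/
noncomputable def interpError (s : Finset ι) (v : ι → F) : F[X] →ₗ[F] F[X] :=
  LinearMap.id - Lagrange.interpolate s v ∘ₗ LinearMap.pi fun i => leval (v i)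

lemma interpError_apply (s : Finset ι) (v : ι → F) (p : F[X]) :
    interpError s v p = p - Lagrange.interpolate s v fun i => p.eval (v i) := rfl

lemma eval_interpError (s : Finset ι) (v : ι → F) (p : F[X]) (x : F) :
    (interpError s v p).eval x =
      p.eval x - ∑ i ∈ s, p.eval (v i) * (Lagrange.basis s v i).eval x := by
  simp [interpError_apply, Lagrange.interpolate_apply, eval_finsetSum]

lemma interpError_eq_zero_of_degree_lt (hv : Set.InjOn v s) (hp : p.degree < #s) :
    interpError s v p = 0 := by
  rw [interpError_apply, ← Lagrange.eq_interpolate hv hp, sub_self]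

lemma interpError_eq_self (hp : ∀ i ∈ s, p.eval (v i) = 0) : interpError s v p = p := by
  simp +contextual [interpError_apply, Lagrange.interpolate_apply, hp]

lemma eval_interpError_node (hv : Set.InjOn v s) (p : F[X]) {i : ι} (hi : i ∈ s) :
    (interpError s v p).eval (v i) = 0 := by
  rw [interpError_apply, eval_sub, Lagrange.eval_interpolate_at_node _ hv hi, sub_self]

lemma interpError_insert_X_sub_C_mul {a : ι} (ha : a ∉ s)
    (hv : Set.InjOn v (insert a s : Finset ι)) (p : F[X]) :
    interpError (insert a s) v ((X - C (v a)) * p) = (X - C (v a)) * interpError s v p := by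
  have hvs : Set.InjOn v s := hv.mono (by simp)
  set I := Lagrange.interpolate s v fun i => p.eval (v i)
  have hI : interpError (insert a s) v ((X - C (v a)) * I) = 0 := by
    refine interpError_eq_zero_of_degree_lt hv ?_
    rw [degree_mul, degree_X_sub_C, card_insert_of_notMem ha, Nat.cast_add, Nat.cast_one, add_comm]
    exact WithBot.add_lt_add_right (by simp) (Lagrange.degree_interpolate_lt _ hvs)
  have hE : interpError (insert a s) v ((X - C (v a)) * interpError s v p) =
      (X - C (v a)) * interpError s v p := by
    refine interpError_eq_self fun i hi => ?_
    rcases mem_insert.1 hi with rfl | hi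
    · simp
    · rw [eval_mul, eval_interpError_node hvs p hi, mul_zero]
  have hp : p = I + interpError s v p := (add_sub_cancel _ _).symm
  conv_lhs => rw [hp]
  rw [mul_add, map_add, hI, hE, zero_add]

lemma X_sub_C_pow_eq_mul_sum_add (b c : F) (k : ℕ) :
    (X - C c) ^ k =
      (X - C b) * ∑ i ∈ range k, (b - c) ^ (k - 1 - i) • (X - C c) ^ i + C ((b - c) ^ k) := by
  have h := (Commute.all (X - C c) (C (b - c))).mul_geom_sum₂ k
  rw [C_sub, sub_sub_sub_cancel_right, ← C_sub] at h
  simp only [smul_eq_C_mul, C_pow, mul_comm (C (b - c) ^ _), h, sub_add_cancel]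

lemma abs_eval_interpError_X_sub_C_pow_le [LinearOrder F] [IsStrictOrderedRing F] {c x ρ : F}
    (hx : |x - c| ≤ ρ) (hv : Set.InjOn v s) (hs : ∀ i ∈ s, |x - v i| + |v i - c| ≤ ρ) (k : ℕ) :
    |(interpError s v ((X - C c) ^ k)).eval x| ≤ ρ ^ k * (k + 1 - #s : ℕ) := by
  have hρ : 0 ≤ ρ := (abs_nonneg _).trans hx
  induction s using Finset.induction_on generalizing k with
  | empty =>
    simp only [interpError_eq_self (s := ∅) (v := v) (by simp), eval_pow, eval_sub, eval_X, eval_C,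
      card_empty, Nat.sub_zero, abs_pow]
    calc |x - c| ^ k ≤ ρ ^ k * 1 := by rw [mul_one]; gcongr
      _ ≤ _ := by gcongr; simp
  | insert a s ha ih =>
    specialize ih (hv.mono (by simp)) fun i hi => hs i (mem_insert_of_mem hi)
    set d := v a - c
    have hd : |x - v a| ≤ ρ - |d| := by linarith [hs a (mem_insert_self _ _)]
    have hconst : interpError (insert a s) v (C (d ^ k)) = 0 :=
      interpError_eq_zero_of_degree_lt hv <| degree_C_le.trans_lt <| by
        rw [card_insert_of_notMem ha]
        exact_mod_cast Nat.succ_pos _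
    have hsum : |∑ i ∈ range k, d ^ (k - 1 - i) * (interpError s v ((X - C c) ^ i)).eval x| ≤
        (∑ i ∈ range k, ρ ^ i * |d| ^ (k - 1 - i)) * (k - #s : ℕ) := by
      rw [sum_mul]
      refine (abs_sum_le_sum_abs _ _).trans (sum_le_sum fun i hi => ?_)
      have hik : i + 1 - #s ≤ k - #s := by rw [mem_range] at hi; omega
      calc |d ^ (k - 1 - i) * (interpError s v ((X - C c) ^ i)).eval x|
          ≤ |d| ^ (k - 1 - i) * (ρ ^ i * (i + 1 - #s : ℕ)) := by
            rw [abs_mul, abs_pow]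
            gcongr
            exact ih i
        _ ≤ |d| ^ (k - 1 - i) * (ρ ^ i * (k - #s : ℕ)) := by gcongr
        _ = _ := by ring
    rw [X_sub_C_pow_eq_mul_sum_add (v a), map_add, hconst, add_zero,
      interpError_insert_X_sub_C_mul ha hv, eval_mul, abs_mul, card_insert_of_notMem ha,
      Nat.add_sub_add_right]
    simp only [map_sum, map_smul, eval_finsetSum, eval_smul, smul_eq_mul, eval_sub, eval_X, eval_C]
    calc |x - v a| * |∑ i ∈ range k, d ^ (k - 1 - i) * (interpError s v ((X - C c) ^ i)).eval x|
        ≤ (ρ - |d|) * ((∑ i ∈ range k, ρ ^ i * |d| ^ (k - 1 - i)) * (k - #s : ℕ)) :=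
          mul_le_mul hd hsum (abs_nonneg _) ((abs_nonneg _).trans hd)
      _ = (ρ ^ k - |d| ^ k) * (k - #s : ℕ) := by
          rw [← mul_assoc, (Commute.all ρ |d|).mul_geom_sum₂]
      _ ≤ ρ ^ k * (k - #s : ℕ) := by
          gcongr
          exact sub_le_self _ (by positivity)

end InterpolationError

section ChebyshevInterpolation

variable {ι : Type*} [DecidableEq ι] {s : Finset ι} {v : ι → ℝ}

lemma abs_eval_T_sub_interpError_T_le (hs : s.Nonempty) (hv : Set.InjOn v s)
    (hT : ∀ i ∈ s, (Chebyshev.T ℝ #s).eval (v i) = 0) {x : ℝ} (hx : |x| ≤ 1) (m : ℕ) :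
    |(Chebyshev.T ℝ m - interpError s v (Chebyshev.T ℝ m)).eval x| ≤ 1 := by
  induction m using Nat.strong_induction_on with
  | _ m ih =>
    rcases lt_trichotomy m #s with h | rfl | h
    · rw [interpError_eq_zero_of_degree_lt hv (by simpa using h), sub_zero]
      exact Chebyshev.abs_eval_T_real_le_one _ hx
    · simp [interpError_eq_self hT]
    · -- Modulo `T #s`, the polynomial `T m` is minus a Chebyshev polynomial of lower index.
      have hfold : Chebyshev.T ℝ m = 2 * Chebyshev.T ℝ #s * Chebyshev.T ℝ (m - #s)
          - Chebyshev.T ℝ (((2 * #s - m : ℤ).natAbs : ℕ) : ℤ) := by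
        rw [Chebyshev.T_mul_T, Chebyshev.T_natAbs]
        ring_nf
      have hself : interpError s v (2 * Chebyshev.T ℝ #s * Chebyshev.T ℝ (m - #s)) =
          2 * Chebyshev.T ℝ #s * Chebyshev.T ℝ (m - #s) :=
        interpError_eq_self fun i hi => by simp [hT i hi]
      rw [hfold, map_sub, hself, sub_sub_sub_cancel_left, ← neg_sub, eval_neg, abs_neg]
      exact ih _ (by have := hs.card_pos; omega)

lemma abs_eval_interpError_T_le (hs : s.Nonempty) (hv : Set.InjOn v s)
    (hT : ∀ i ∈ s, (Chebyshev.T ℝ #s).eval (v i) = 0) {x : ℝ} (hx : |x| ≤ 1) {u : ℝ} (hu : 1 ≤ u)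
    (m : ℤ) :
    |(interpError s v (Chebyshev.T ℝ m)).eval x| ≤ 2 * (u ^ #s)⁻¹ * (u ^ m + u ^ (-m)) := by
  have hu0 : 0 < u := one_pos.trans_le hu
  rw [← Chebyshev.T_natAbs]
  rcases lt_or_ge m.natAbs #s with h | h
  · have hdeg : (Chebyshev.T ℝ m.natAbs).degree < #s := by
      rwa [Chebyshev.degree_T, Int.natAbs_natCast, Nat.cast_lt]
    rw [interpError_eq_zero_of_degree_lt hv hdeg, eval_zero, abs_zero]
    positivity
  · have hpow : u ^ m.natAbs ≤ u ^ m + u ^ (-m) := by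
      rw [← zpow_natCast, Int.natCast_natAbs]
      rcases abs_choice m with hm | hm <;> rw [hm]
      · exact le_add_of_nonneg_right (zpow_nonneg hu0.le _)
      · exact le_add_of_nonneg_left (zpow_nonneg hu0.le _)
    have hone : 1 ≤ (u ^ #s)⁻¹ * (u ^ m + u ^ (-m)) := by
      rw [inv_mul_eq_div, one_le_div (by positivity)]
      exact (pow_le_pow_right₀ hu h).trans hpow
    have hTm := abs_eval_T_sub_interpError_T_le hs hv hT hx m.natAbs
    have hTx := Chebyshev.abs_eval_T_real_le_one m.natAbs hx
    rw [eval_sub] at hTm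
    rw [abs_le] at *
    constructor <;> linarith

lemma X_pow_succ_mul_T (k : ℕ) (m : ℤ) :
    X ^ (k + 1) * Chebyshev.T ℝ m =
      (1 / 2 : ℝ) • (X ^ k * Chebyshev.T ℝ (m + 1) + X ^ k * Chebyshev.T ℝ (m - 1)) := by
  rw [one_div, eq_inv_smul_iff₀ two_ne_zero, Chebyshev.T_add_one, two_smul]
  ring

-- Both sides satisfy the recursion `2 X T m = T (m + 1) + T (m - 1)` of the Chebyshev polynomials.
lemma abs_eval_interpError_X_pow_mul_T_le (hs : s.Nonempty) (hv : Set.InjOn v s)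
    (hT : ∀ i ∈ s, (Chebyshev.T ℝ #s).eval (v i) = 0) {x : ℝ} (hx : |x| ≤ 1) {u : ℝ} (hu : 1 ≤ u)
    (k : ℕ) (m : ℤ) :
    |(interpError s v (X ^ k * Chebyshev.T ℝ m)).eval x| ≤
      2 * (u ^ #s)⁻¹ * (u ^ m + u ^ (-m)) * ((u + u⁻¹) / 2) ^ k := by
  have hu0 : u ≠ 0 := (one_pos.trans_le hu).ne'
  induction k generalizing m with
  | zero => simpa using abs_eval_interpError_T_le hs hv hT hx hu m
  | succ k ih =>
    rw [X_pow_succ_mul_T, map_smul, map_add, eval_smul, eval_add, smul_eq_mul, abs_mul,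
      abs_of_pos (by norm_num : (0 : ℝ) < 1 / 2)]
    calc _ ≤ 1 / 2 * (2 * (u ^ #s)⁻¹ * (u ^ (m + 1) + u ^ (-(m + 1))) * ((u + u⁻¹) / 2) ^ k +
          2 * (u ^ #s)⁻¹ * (u ^ (m - 1) + u ^ (-(m - 1))) * ((u + u⁻¹) / 2) ^ k) := by
          gcongr
          exact (abs_add_le _ _).trans (add_le_add (ih _) (ih _))
      _ = _ := by
          rw [neg_add, neg_sub, sub_eq_add_neg, sub_eq_add_neg, zpow_add₀ hu0, zpow_add₀ hu0,
            zpow_add₀ hu0, zpow_add₀ hu0, zpow_one, zpow_neg_one]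
          ring

lemma abs_eval_interpError_X_pow_le (hs : s.Nonempty) (hv : Set.InjOn v s)
    (hT : ∀ i ∈ s, (Chebyshev.T ℝ #s).eval (v i) = 0) {x : ℝ} (hx : |x| ≤ 1) {u : ℝ} (hu : 1 ≤ u)
    (k : ℕ) :
    |(interpError s v (X ^ k)).eval x| ≤ 4 * (u ^ #s)⁻¹ * ((u + u⁻¹) / 2) ^ k := by
  have h := abs_eval_interpError_X_pow_mul_T_le hs hv hT hx hu k 0
  rw [Chebyshev.T_zero, mul_one, neg_zero, zpow_zero] at h
  linarith

/-- The zeros of the Chebyshev polynomial of degree `n`, in decreasing order. -/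
noncomputable def chebyshevNode (n : ℕ) (k : Fin n) : SymInterval :=
  ⟨Real.cos ((2 * (k : ℕ) + 1) * Real.pi / (2 * n)), Real.cos_mem_Icc _⟩

lemma eval_T_chebyshevNode (n : ℕ) (k : Fin n) :
    (Chebyshev.T ℝ n).eval (chebyshevNode n k : ℝ) = 0 :=
  isRoot_of_mem_roots <| by
    rw [Chebyshev.roots_T_real, Finset.mem_val]
    exact mem_image_of_mem _ (mem_range.2 k.isLt)

lemma chebyshevNode_injective (n : ℕ) : Function.Injective (chebyshevNode n) := fun i j hij =>
  Fin.ext <| Multiset.inj_on_of_nodup_map (Chebyshev.roots_T_real_nodup n) _ (by simp) _ (by simp)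
    (congrArg Subtype.val hij)

end ChebyshevInterpolation

section ChebyshevCoefficients

variable (R : Type*) [CommRing R]

lemma coeff_U_self (m : ℕ) : (Chebyshev.U R m).coeff m = 2 ^ m := by
  have h := Chebyshev.leadingCoeff_U_natCast ℤ m
  rw [leadingCoeff, Chebyshev.natDegree_U_natCast] at h
  rw [← Chebyshev.map_U (Int.castRingHom R), coeff_map, h]
  simp

lemma coeff_U_add_two_mul (i m : ℕ) :
    (Chebyshev.U R (m + 2 * i : ℕ)).coeff m = (-1) ^ i * 2 ^ m * ((m + i).choose i : R) := by
  induction i generalizing m with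
  | zero => simpa using coeff_U_self R m
  | succ i ihi =>
    have hrec (p : ℕ) : Chebyshev.U R (p + 2 : ℕ) =
        C 2 * (X * Chebyshev.U R (p + 1 : ℕ)) - Chebyshev.U R p := by
      rw [← mul_assoc]
      exact_mod_cast Chebyshev.U_add_two R p
    induction m with
    | zero =>
      have h0 := ihi 0
      rw [zero_add] at h0 ⊢
      rw [mul_add_one, hrec, coeff_sub, h0, coeff_C_mul, coeff_X_mul_zero]
      simp [pow_succ]
    | succ m ihm =>
      rw [mul_add_one, ← add_assoc, hrec, coeff_sub, ihi (m + 1), coeff_C_mul, coeff_X_mul,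
        show m + 1 + 2 * i + 1 = m + 2 * (i + 1) by ring, ihm,
        show m + 1 + (i + 1) = m + 1 + i + 1 by ring, Nat.choose_succ_succ,
        show m + (i + 1) = m + 1 + i by ring]
      push_cast
      ring

lemma two_mul_coeff_T_add_two_mul_succ (i m : ℕ) :
    2 * (Chebyshev.T R (m + 2 * (i + 1) : ℕ)).coeff m =
      (-1) ^ (i + 1) * 2 ^ m * ((m + i + 1).choose (i + 1) + (m + i).choose i) := by
  have h := congrArg (fun p => coeff p m) (Chebyshev.two_mul_T_eq_U_sub_U R (m + 2 * i : ℕ))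
  rw [show ((m + 2 * i : ℕ) : ℤ) + 2 = (m + 2 * (i + 1) : ℕ) by push_cast; ring] at h
  simp only [coeff_sub, coeff_U_add_two_mul, coeff_ofNat_mul, ← add_assoc] at h
  rw [h]
  ring

lemma two_mul_factorial_mul_coeff_T_add_two_mul_succ (i m : ℕ) :
    2 * ((i + 1).factorial * m.factorial * (Chebyshev.T R (m + 2 * (i + 1) : ℕ)).coeff m) =
      (-1) ^ (i + 1) * 2 ^ m * ((m + 2 * (i + 1) : ℕ) * (m + i).factorial) := by
  have h : ((m + i + 1).choose (i + 1) + (m + i).choose i) * ((i + 1).factorial * m.factorial) =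
      (m + 2 * (i + 1)) * (m + i).factorial := by
    have h1 := Nat.add_choose_mul_factorial_mul_factorial m (i + 1)
    have h2 := Nat.add_choose_mul_factorial_mul_factorial m i
    rw [← add_assoc, Nat.factorial_succ (m + i)] at h1
    rw [Nat.factorial_succ i] at h1 ⊢
    linear_combination h1 + (i + 1) * h2
  have h' := congrArg (Nat.cast : ℕ → R) h
  have hT := two_mul_coeff_T_add_two_mul_succ R i m
  generalize (Chebyshev.T R (m + 2 * (i + 1) : ℕ)).coeff m = t at hT ⊢
  push_cast at h' ⊢
  linear_combination ((i + 1).factorial * m.factorial : R) * hT + (-1) ^ (i + 1) * 2 ^ m * h'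

lemma coeff_T_eq_zero_of_odd {k m : ℕ} (h : Odd (k + m)) : (Chebyshev.T R k).coeff m = 0 := by
  induction k using Nat.strong_induction_on generalizing m with
  | _ k ih =>
    match k with
    | 0 =>
      rw [Nat.cast_zero, Chebyshev.T_zero, coeff_one, if_neg]
      rintro rfl
      simp at h
    | 1 =>
      rw [Nat.cast_one, Chebyshev.T_one, coeff_X, if_neg]
      rintro rfl
      exact absurd h (by decide)
    | k + 2 =>
      have hk : (Chebyshev.T R k).coeff m = 0 := ih k (by omega) (by grind)
      have hrec : Chebyshev.T R (k + 2 : ℕ) =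
          C 2 * (X * Chebyshev.T R (k + 1 : ℕ)) - Chebyshev.T R k := by
        rw [← mul_assoc]
        exact_mod_cast Chebyshev.T_add_two R k
      rw [hrec, coeff_sub, coeff_C_mul, hk]
      cases m with
      | zero => simp
      | succ m => rw [coeff_X_mul, ih (k + 1) (by omega) (by grind), mul_zero, sub_zero]

end ChebyshevCoefficients

lemma factorial_add_sq_le (m i : ℕ) :
    (m + i).factorial ^ 2 ≤ m.factorial * (m + 2 * i).factorial := by
  induction i with
  | zero => simp [sq]
  | succ i ih =>
    calc (m + (i + 1)).factorial ^ 2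
        = (m + i + 1) * (m + i + 1) * (m + i).factorial ^ 2 := by
          rw [← add_assoc, Nat.factorial_succ]
          ring
      _ ≤ (m + 2 * i + 1 + 1) * (m + 2 * i + 1) * (m.factorial * (m + 2 * i).factorial) :=
          Nat.mul_le_mul (Nat.mul_le_mul (by omega) (by omega)) ih
      _ = m.factorial * (m + 2 * (i + 1)).factorial := by
          rw [show m + 2 * (i + 1) = m + 2 * i + 1 + 1 by ring, Nat.factorial_succ,
            Nat.factorial_succ]
          ring

lemma factorial_mul_sq_coeff_T_self_le {k : ℕ} (hk : 2 ≤ k) :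
    (k.factorial : ℝ) * (Chebyshev.T ℝ k).coeff k ^ 2 ≤
      k / (k - 1) * (4 ^ k / 4 * k.factorial) := by
  obtain ⟨k, rfl⟩ := Nat.exists_eq_add_of_le' hk
  have hlead := Chebyshev.leadingCoeff_T ℝ (k + 2 : ℕ)
  rw [leadingCoeff, Chebyshev.natDegree_T, Int.natAbs_natCast] at hlead
  have hratio : (1 : ℝ) ≤ (k + 2 : ℕ) / ((k + 2 : ℕ) - 1) := by
    push_cast
    rw [one_le_div] <;> linarith [(k.cast_nonneg : (0 : ℝ) ≤ k)]
  calc _ = 1 * (4 ^ (k + 2) / 4 * ((k + 2).factorial : ℝ)) := by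
        rw [hlead, show (4 : ℝ) = 2 ^ 2 by norm_num]
        simp only [Nat.add_one_sub_one, ← pow_mul]
        ring
    _ ≤ _ := by gcongr

lemma factorial_mul_sq_coeff_T_add_two_mul_succ_le (i m : ℕ) :
    (m.factorial : ℝ) * (Chebyshev.T ℝ (m + 2 * (i + 1) : ℕ)).coeff m ^ 2 ≤
      (m + 2 * (i + 1) : ℕ) / ((m + 2 * (i + 1) : ℕ) - 1) *
        (4 ^ m / 4 * ((m + 2 * (i + 1)).factorial / ((i + 1).factorial : ℝ) ^ 2)) := by
  have hT := two_mul_factorial_mul_coeff_T_add_two_mul_succ ℝ i m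
  generalize (Chebyshev.T ℝ (m + 2 * (i + 1) : ℕ)).coeff m = c at hT ⊢
  have hc : ((i + 1).factorial * m.factorial * c) ^ 2 =
      4 ^ m / 4 * ((m + 2 * (i + 1) : ℕ) ^ 2 * ((m + i).factorial : ℝ) ^ 2) := by
    have h := congrArg (· ^ 2) hT
    simp only [mul_pow _ _ 2, ← pow_mul _ _ 2, mul_comm _ 2, pow_mul _ 2] at h
    norm_num at h
    push_cast
    linear_combination h / 4
  have hfact : ((m + i).factorial : ℝ) ^ 2 ≤ m.factorial * (m + 2 * i).factorial := by
    exact_mod_cast factorial_add_sq_le m i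
  have hk1 : ((m + 2 * (i + 1) : ℕ) : ℝ) - 1 = (m + 2 * i + 1 : ℕ) := by push_cast; ring
  calc (m.factorial : ℝ) * c ^ 2
      = 4 ^ m / 4 * ((m + 2 * (i + 1) : ℕ) ^ 2 * ((m + i).factorial : ℝ) ^ 2) /
          (m.factorial * ((i + 1).factorial : ℝ) ^ 2) := by
        rw [← hc]
        field_simp
    _ ≤ 4 ^ m / 4 * ((m + 2 * (i + 1) : ℕ) ^ 2 * (m.factorial * (m + 2 * i).factorial)) /
          (m.factorial * ((i + 1).factorial : ℝ) ^ 2) := by gcongr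
    _ = _ := by
        rw [hk1, show m + 2 * (i + 1) = m + 2 * i + 1 + 1 by ring,
          Nat.factorial_succ (m + 2 * i + 1), Nat.factorial_succ (m + 2 * i)]
        field_simp
        push_cast
        ring

lemma factorial_mul_sq_coeff_T_le {i m : ℕ} (h : 2 ≤ m + 2 * i) :
    (m.factorial : ℝ) * (Chebyshev.T ℝ (m + 2 * i : ℕ)).coeff m ^ 2 ≤
      (m + 2 * i : ℕ) / ((m + 2 * i : ℕ) - 1) *
        (4 ^ m / 4 * ((m + 2 * i).factorial / (i.factorial : ℝ) ^ 2)) := by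
  cases i with
  | zero => simpa using factorial_mul_sq_coeff_T_self_le h
  | succ i => exact factorial_mul_sq_coeff_T_add_two_mul_succ_le i m

section ChebyshevExpansion

lemma exists_eq_sum_smul_T {n : ℕ} {p : ℝ[X]} (hp : p.degree ≤ n) :
    ∃ a : ℕ → ℝ, p = ∑ k ∈ range (n + 1), a k • Chebyshev.T ℝ k := by
  have hmem : p ∈ degreeLT ℝ (n + 1) :=
    mem_degreeLT.2 (hp.trans_lt (by exact_mod_cast Nat.lt_succ_self n))
  rw [← Sequence.span_degreeLT (Chebyshev.chebyshevTsequence ℝ) (by simp),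
    show Set.Iio (n + 1) = ↑(range (n + 1)) by simp,
    Submodule.mem_span_image_finset_iff_exists_fun'] at hmem
  obtain ⟨a, ha⟩ := hmem
  exact ⟨a, by simpa [Chebyshev.chebyshevTsequence] using ha.symm⟩

lemma integral_eval_T_mul_eval_T_measureT (i j : ℕ) :
    ∫ x, (Chebyshev.T ℝ i).eval x * (Chebyshev.T ℝ j).eval x ∂Chebyshev.measureT =
      if i = j then (if i = 0 then Real.pi else Real.pi / 2) else 0 := by
  split_ifs with hij hi
  · subst hij hi
    exact_mod_cast Chebyshev.integral_eval_T_real_mul_self_measureT_zero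
  · subst hij
    exact Chebyshev.integral_T_real_mul_self_measureT_of_ne_zero hi
  · exact Chebyshev.integral_eval_T_real_mul_eval_T_real_measureT_of_ne hij

lemma integral_sq_eval_sum_smul_T_measureT (s : Finset ℕ) (a : ℕ → ℝ) :
    ∫ x, (∑ k ∈ s, a k • Chebyshev.T ℝ k).eval x ^ 2 ∂Chebyshev.measureT =
      ∑ k ∈ s, (if k = 0 then Real.pi else Real.pi / 2) * a k ^ 2 := by
  have hexpand (x : ℝ) : (∑ k ∈ s, a k • Chebyshev.T ℝ k).eval x ^ 2 =
      ∑ i ∈ s, ∑ j ∈ s,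
        a i * a j * ((Chebyshev.T ℝ i).eval x * (Chebyshev.T ℝ j).eval x) := by
    simp only [eval_finsetSum, eval_smul, smul_eq_mul, sq, sum_mul_sum]
    exact sum_congr rfl fun i _ => sum_congr rfl fun j _ => by ring
  have hint (i j : ℕ) : MeasureTheory.Integrable (fun x : ℝ => a i * a j *
      ((Chebyshev.T ℝ i).eval x * (Chebyshev.T ℝ j).eval x)) Chebyshev.measureT :=
    Chebyshev.integrable_measureT (by fun_prop)
  simp only [hexpand]
  rw [MeasureTheory.integral_finsetSum _ fun i _ =>
    MeasureTheory.integrable_finsetSum _ fun j _ => hint i j]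
  refine sum_congr rfl fun i hi => ?_
  rw [MeasureTheory.integral_finsetSum _ fun j _ => hint i j]
  simp only [MeasureTheory.integral_const_mul, integral_eval_T_mul_eval_T_measureT, mul_ite,
    mul_zero, sum_ite_eq, if_pos hi]
  split_ifs <;> ring

lemma sum_sq_le_of_abs_eval_sum_smul_T_le {s : Finset ℕ} {a : ℕ → ℝ} {M : ℝ}
    (hM : ∀ x : ℝ, |x| ≤ 1 → |(∑ k ∈ s, a k • Chebyshev.T ℝ k).eval x| ≤ M) :
    ∑ k ∈ s, a k ^ 2 ≤ 2 * M ^ 2 := by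
  set p := ∑ k ∈ s, a k • Chebyshev.T ℝ k
  refine le_of_mul_le_mul_left ?_ (half_pos Real.pi_pos)
  calc Real.pi / 2 * ∑ k ∈ s, a k ^ 2
      ≤ ∑ k ∈ s, (if k = 0 then Real.pi else Real.pi / 2) * a k ^ 2 := by
        rw [mul_sum]
        gcongr with k
        split_ifs <;> linarith [Real.pi_pos]
    _ = ∫ θ in (0 : ℝ)..Real.pi, p.eval (Real.cos θ) ^ 2 := by
        rw [← integral_sq_eval_sum_smul_T_measureT, Chebyshev.integral_measureT_eq_integral_cos]
    _ ≤ ∫ θ in (0 : ℝ)..Real.pi, M ^ 2 := by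
        refine intervalIntegral.integral_mono_on Real.pi_pos.le
          (Continuous.intervalIntegrable (by fun_prop) _ _) (by simp) fun θ _ => ?_
        rw [← sq_abs]
        gcongr
        exact hM _ (Real.abs_cos_le_one θ)
    _ = Real.pi / 2 * (2 * M ^ 2) := by
        rw [intervalIntegral.integral_const, smul_eq_mul]
        ring

end ChebyshevExpansion

/-- The squared norm of a polynomial in the reproducing kernel Hilbert space of `exp (l x y)`, in
which the monomials are orthogonal and `‖X ^ m‖² = m! / l ^ m`. -/
noncomputable def expNormSq (l : ℝ) (p : ℝ[X]) : ℝ :=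
  p.sum fun m a => m.factorial / l ^ m * a ^ 2

section ExpNormSq

variable {l : ℝ}

lemma expNormSq_eq_sum_of_support_subset (l : ℝ) {p : ℝ[X]} {s : Finset ℕ} (hs : p.support ⊆ s) :
    expNormSq l p = ∑ m ∈ s, m.factorial / l ^ m * p.coeff m ^ 2 :=
  p.sum_eq_of_subset _ (by simp) hs

lemma expNormSq_nonneg (hl : 0 ≤ l) (p : ℝ[X]) : 0 ≤ expNormSq l p :=
  sum_nonneg fun _ _ => by positivity

lemma expNormSq_pos (hl : 0 < l) {p : ℝ[X]} (hp : p ≠ 0) : 0 < expNormSq l p :=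
  sum_pos (fun m hm => by
    have := mem_support_iff.1 hm
    positivity) (nonempty_support_iff.2 hp)

lemma expNormSq_sum_smul_le (hl : 0 ≤ l) (s : Finset ℕ) (a : ℕ → ℝ) (q : ℕ → ℝ[X]) :
    expNormSq l (∑ k ∈ s, a k • q k) ≤ (∑ k ∈ s, a k ^ 2) * ∑ k ∈ s, expNormSq l (q k) := by
  set t := (∑ k ∈ s, a k • q k).support ∪ s.biUnion fun k => (q k).support
  have hq : ∀ k ∈ s, expNormSq l (q k) = ∑ m ∈ t, m.factorial / l ^ m * (q k).coeff m ^ 2 :=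
    fun k hk => expNormSq_eq_sum_of_support_subset l
      ((subset_biUnion_of_mem (fun k => (q k).support) hk).trans subset_union_right)
  rw [expNormSq_eq_sum_of_support_subset l subset_union_left, sum_congr rfl hq, sum_comm, mul_sum]
  refine sum_le_sum fun m _ => ?_
  simp only [finsetSum_coeff, coeff_smul, smul_eq_mul]
  calc (m.factorial / l ^ m : ℝ) * (∑ k ∈ s, a k * (q k).coeff m) ^ 2
      ≤ m.factorial / l ^ m * ((∑ k ∈ s, a k ^ 2) * ∑ k ∈ s, (q k).coeff m ^ 2) := by
        gcongr
        exact sum_mul_sq_le_sq_mul_sq _ _ _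
    _ = _ := by
        rw [← mul_sum]
        ring

lemma expNormSq_le_of_abs_eval_le (hl : 0 ≤ l) {n : ℕ} {p : ℝ[X]} (hp : p.degree ≤ n) {M : ℝ}
    (hM : ∀ x : ℝ, |x| ≤ 1 → |p.eval x| ≤ M) :
    expNormSq l p ≤ 2 * M ^ 2 * ∑ k ∈ range (n + 1), expNormSq l (Chebyshev.T ℝ k) := by
  obtain ⟨a, rfl⟩ := exists_eq_sum_smul_T hp
  refine (expNormSq_sum_smul_le hl _ _ _).trans ?_
  gcongr
  · exact sum_nonneg fun k _ => expNormSq_nonneg hl _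
  · exact sum_sq_le_of_abs_eval_sum_smul_T_le hM

lemma sum_range_eq_sum_sub_two_mul {M : Type*} [AddCommMonoid M] {f : ℕ → M} {k : ℕ}
    (hf : ∀ m, Odd (k + m) → f m = 0) :
    ∑ m ∈ range (k + 1), f m = ∑ i ∈ range (k / 2 + 1), f (k - 2 * i) := by
  symm
  refine sum_of_injOn (fun i => k - 2 * i) ?_ ?_ (fun m hm hm' => hf m ?_) fun _ _ => rfl
  · intro i hi j hj hij
    simp only [coe_range, Set.mem_Iio] at hi hj hij
    omega
  · intro i hi
    simp only [coe_range, Set.mem_Iio] at hi ⊢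
    omega
  · by_contra h
    rw [Nat.not_odd_iff] at h
    rw [mem_range] at hm
    refine hm' ⟨(k - m) / 2, ?_, ?_⟩
    · simp only [coe_range, Set.mem_Iio]
      omega
    · dsimp only
      omega

lemma expNormSq_T_le_of_two_le (hl : 0 < l) {k : ℕ} (hk : 2 ≤ k) :
    expNormSq l (Chebyshev.T ℝ k) ≤
      k / (k - 1) * (4 ^ k / 4 * (k.factorial / l ^ k) * Real.exp (l ^ 2 / 16)) := by
  have hk1 : (0 : ℝ) < k - 1 := by
    rw [sub_pos]
    exact_mod_cast hk
  have hsupp : (Chebyshev.T ℝ k).support ⊆ range (k + 1) :=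
    supp_subset_range (by simp)
  rw [expNormSq_eq_sum_of_support_subset l hsupp, sum_range_eq_sum_sub_two_mul fun m hm => by
    rw [coeff_T_eq_zero_of_odd ℝ hm, sq, mul_zero, mul_zero]]
  calc _ ≤ ∑ i ∈ range (k / 2 + 1),
        k / (k - 1) * (4 ^ k / 4 * (k.factorial / l ^ k) * ((l ^ 2 / 16) ^ i / i.factorial)) := by
        refine sum_le_sum fun i hi => ?_
        obtain ⟨m, rfl⟩ : ∃ m, k = m + 2 * i :=
          Nat.exists_eq_add_of_le' (by rw [mem_range] at hi; omega)
        rw [Nat.add_sub_cancel]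
        have hi1 : (1 : ℝ) ≤ i.factorial := by exact_mod_cast i.factorial_pos
        calc m.factorial / l ^ m * (Chebyshev.T ℝ (m + 2 * i : ℕ)).coeff m ^ 2
            = m.factorial * (Chebyshev.T ℝ (m + 2 * i : ℕ)).coeff m ^ 2 / l ^ m := by ring
          _ ≤ (m + 2 * i : ℕ) / ((m + 2 * i : ℕ) - 1) *
                (4 ^ m / 4 * ((m + 2 * i).factorial / (i.factorial : ℝ) ^ 2)) / l ^ m := by
              exact div_le_div_of_nonneg_right (factorial_mul_sq_coeff_T_le hk) (by positivity)
          _ ≤ (m + 2 * i : ℕ) / ((m + 2 * i : ℕ) - 1) *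
                (4 ^ m / 4 * ((m + 2 * i).factorial / i.factorial)) / l ^ m := by
              gcongr
              exact le_self_pow₀ hi1 two_ne_zero
          _ = _ := by
              rw [div_pow, show (16 : ℝ) = 4 ^ 2 by norm_num, ← pow_mul, ← pow_mul, pow_add,
                pow_add]
              field_simp
    _ ≤ _ := by
        rw [← mul_sum, ← mul_sum]
        gcongr
        exact Real.sum_le_exp_of_nonneg (by positivity) _

lemma expNormSq_T_le (hl : 0 < l) (k : ℕ) :
    expNormSq l (Chebyshev.T ℝ k) ≤ 4 ^ k * (k.factorial / l ^ k) * Real.exp (l ^ 2 / 16) := by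
  have hexp : 1 ≤ Real.exp (l ^ 2 / 16) := Real.one_le_exp (by positivity)
  match k with
  | 0 =>
    rw [Nat.cast_zero, Chebyshev.T_zero, ← C_1, expNormSq, sum_C_index (by simp)]
    simpa using hexp
  | 1 =>
    suffices 1 / l ≤ 4 * (1 / l) * Real.exp (l ^ 2 / 16) by
      simpa [expNormSq, sum_X_index] using this
    have : 0 < 1 / l := by positivity
    nlinarith
  | k + 2 =>
    refine (expNormSq_T_le_of_two_le hl (Nat.le_add_left 2 k)).trans ?_
    have hratio : ((k + 2 : ℕ) : ℝ) / ((k + 2 : ℕ) - 1) ≤ 4 := by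
      push_cast
      have : (0 : ℝ) ≤ k := k.cast_nonneg
      rw [div_le_iff₀ (by linarith)]
      linarith
    calc _ ≤ 4 * (4 ^ (k + 2) / 4 * ((k + 2).factorial / l ^ (k + 2)) *
          Real.exp (l ^ 2 / 16)) := by gcongr
      _ = _ := by ring

lemma pow_le_exp_mul_descFactorial {n j : ℕ} (h : j ≤ n) :
    (n : ℝ) ^ j ≤ Real.exp j * n.descFactorial j := by
  induction j generalizing n with
  | zero => simp
  | succ j ih =>
    obtain ⟨n, rfl⟩ := Nat.exists_eq_add_of_le' (Nat.one_le_of_lt h)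
    have hjn : j ≤ n := by omega
    have hpow : ((n : ℝ) + 1) ^ j ≤ Real.exp 1 * n ^ j := by
      rcases n.eq_zero_or_pos with rfl | hn
      · obtain rfl : j = 0 := by omega
        simp
      have hn0 : (0 : ℝ) < n := by exact_mod_cast hn
      calc ((n : ℝ) + 1) ^ j = (1 / n + 1) ^ j * n ^ j := by
            rw [← mul_pow]
            congr 1
            field_simp
            ring
        _ ≤ Real.exp (1 / n) ^ j * n ^ j := by
            gcongr
            exact Real.add_one_le_exp _
        _ = Real.exp (j / n) * n ^ j := by
            rw [← Real.exp_nat_mul, mul_one_div]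
        _ ≤ Real.exp 1 * n ^ j := by
            gcongr
            rw [div_le_one hn0]
            exact_mod_cast hjn
    rw [Nat.succ_descFactorial_succ]
    push_cast
    calc ((n : ℝ) + 1) ^ (j + 1) = (n + 1) ^ j * (n + 1) := by ring
      _ ≤ Real.exp 1 * (Real.exp j * n.descFactorial j) * (n + 1) := by
          gcongr
          exact hpow.trans (by gcongr; exact ih hjn)
      _ = _ := by
          rw [Real.exp_add]
          ring

lemma factorial_mul_pow_le_three_pow_mul_factorial (k j : ℕ) :
    (k.factorial : ℝ) * (k + j : ℕ) ^ j ≤ 3 ^ j * (k + j).factorial := by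
  have hexp : Real.exp j ≤ 3 ^ j := by
    rw [← mul_one (j : ℝ), Real.exp_nat_mul]
    gcongr
    linarith [Real.exp_one_lt_d9]
  have hfact : (k.factorial : ℝ) * (k + j).descFactorial j = (k + j).factorial := by
    have := Nat.factorial_mul_descFactorial (Nat.le_add_left j k)
    rw [Nat.add_sub_cancel] at this
    exact_mod_cast this
  rw [← hfact, mul_left_comm]
  gcongr
  exact (pow_le_exp_mul_descFactorial (Nat.le_add_left j k)).trans (by gcongr)

lemma sum_range_four_pow_mul_factorial_div_le (hl : 0 < l) {n : ℕ} (hn : 0 < n)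
    (hln : 5 * l ≤ n) :
    ∑ k ∈ range n, 4 ^ k * (k.factorial / l ^ k) ≤ l / n * (4 ^ n * (n.factorial / l ^ n)) := by
  have hn0 : (0 : ℝ) < n := by exact_mod_cast hn
  set r := 3 / 4 * (l / n)
  have hr0 : 0 ≤ r := by positivity
  have hr1 : r ≤ 3 / 20 := by
    have : l / n ≤ 1 / 5 := by rw [div_le_iff₀ hn0]; linarith
    simp only [r]
    linarith
  have hterm : ∀ k ∈ range n, 4 ^ k * (k.factorial / l ^ k) ≤
      4 ^ n * (n.factorial / l ^ n) * r ^ (n - k) := by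
    intro k hk
    obtain ⟨j, rfl⟩ := Nat.exists_eq_add_of_le (mem_range.1 hk).le
    rw [Nat.add_sub_cancel_left]
    calc (4 : ℝ) ^ k * (k.factorial / l ^ k)
        = 4 ^ k / l ^ k / (k + j : ℕ) ^ j * (k.factorial * (k + j : ℕ) ^ j) := by field_simp
      _ ≤ 4 ^ k / l ^ k / (k + j : ℕ) ^ j * (3 ^ j * (k + j).factorial) := by
          exact mul_le_mul_of_nonneg_left (factorial_mul_pow_le_three_pow_mul_factorial k j)
            (by positivity)
      _ = _ := by
          simp only [r, mul_pow, div_pow, pow_add]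
          field_simp
  have hgeom : ∑ j ∈ range n, r ^ (j + 1) ≤ l / n := by
    have hsum : ∑ j ∈ range n, r ^ j ≤ 4 / 3 := by
      have h := mul_neg_geom_sum r n
      have hrn : 0 ≤ r ^ n := by positivity
      have hS : 0 ≤ ∑ j ∈ range n, r ^ j := sum_nonneg fun j _ => by positivity
      nlinarith
    calc ∑ j ∈ range n, r ^ (j + 1) = r * ∑ j ∈ range n, r ^ j := by
          rw [mul_sum]
          exact sum_congr rfl fun j _ => pow_succ' r j
      _ ≤ r * (4 / 3) := by gcongr
      _ = l / n := by ring
  calc _ ≤ ∑ k ∈ range n, 4 ^ n * (n.factorial / l ^ n) * r ^ (n - k) := sum_le_sum hterm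
    _ = (∑ j ∈ range n, r ^ (j + 1)) * (4 ^ n * (n.factorial / l ^ n)) := by
        rw [← mul_sum, mul_comm, ← sum_range_reflect (fun j => r ^ (j + 1))]
        congr 1
        refine sum_congr rfl fun k hk => congrArg (r ^ ·) ?_
        rw [mem_range] at hk
        omega
    _ ≤ _ := by gcongr

lemma sum_expNormSq_T_le (hl : 0 < l) {n : ℕ} (hn : 7 ≤ n) (hln : 5 * l ≤ n) (h9 : 9 ≤ l * n) :
    ∑ k ∈ range (n + 1), expNormSq l (Chebyshev.T ℝ k) ≤
      4 ^ n / 4 * (n.factorial / l ^ n) * ((1 + l) * Real.exp (l ^ 2 / 16)) := by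
  have hn7 : (7 : ℝ) ≤ n := by exact_mod_cast hn
  have hlower : ∑ k ∈ range n, expNormSq l (Chebyshev.T ℝ k) ≤
      l / n * (4 ^ n * (n.factorial / l ^ n)) * Real.exp (l ^ 2 / 16) := by
    refine (sum_le_sum fun k _ => expNormSq_T_le hl k).trans ?_
    rw [← sum_mul]
    gcongr
    exact sum_range_four_pow_mul_factorial_div_le hl (by omega) hln
  have hconst : (n : ℝ) / (n - 1) + 4 * (l / n) ≤ 1 + l := by
    have hn1 : (0 : ℝ) < n - 1 := by linarith
    have hl' : 9 / n ≤ l := by rwa [div_le_iff₀ (by linarith)]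
    calc (n : ℝ) / (n - 1) + 4 * (l / n) ≤ (1 + 3 / 7 * (9 / n)) + 4 / 7 * l := by
          gcongr ?_ + ?_
          · rw [div_le_iff₀ hn1]
            field_simp
            nlinarith
          · rw [← mul_div_assoc, div_le_iff₀ (by linarith)]
            nlinarith
      _ ≤ 1 + l := by linarith
  rw [sum_range_succ]
  calc _ ≤ l / n * (4 ^ n * (n.factorial / l ^ n)) * Real.exp (l ^ 2 / 16) +
        n / (n - 1) * (4 ^ n / 4 * (n.factorial / l ^ n) * Real.exp (l ^ 2 / 16)) :=
        add_le_add hlower (expNormSq_T_le_of_two_le hl (by omega))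
    _ = 4 ^ n / 4 * (n.factorial / l ^ n) * ((n / (n - 1) + 4 * (l / n)) *
          Real.exp (l ^ 2 / 16)) := by ring
    _ ≤ _ := by gcongr

end ExpNormSq

section LowerBound

variable {ε τ : ℝ} {H : Type*} [NormedAddCommGroup H] [InnerProductSpace ℝ H] [CompleteSpace H]
  [RKHS ℝ H SymInterval ℝ] {n : ℕ}

lemma one_le_exp_mul_sq_hermiteWeight_zero (ε τ : ℝ) (x : SymInterval) :
    1 ≤ Real.exp (ε ^ 2) * hermiteWeight ε τ 0 x ^ 2 := by
  have hx : (x : ℝ) ^ 2 ≤ 1 := (sq_le_one_iff_abs_le_one _).2 (abs_le.2 x.2)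
  rw [hermiteWeight, ← Real.exp_nat_mul, ← Real.exp_add]
  refine Real.one_le_exp ?_
  push_cast
  nlinarith [mul_nonneg (sq_nonneg ε) (sub_nonneg.2 hx)]

lemma LinearApprox.sq_eval_le_of_eval_node_eq_zero (hl : 0 < τ ^ 2 * ε ^ 2)
    (hH : HasReproducingKernel H (analyticHermiteKernel ε τ)) (A : LinearApprox n)
    {p : ℝ[X]} (hp : ∀ k, p.eval (A.node k : ℝ) = 0) (x : SymInterval) :
    p.eval (x : ℝ) ^ 2 ≤
      Real.exp (ε ^ 2) * expNormSq (τ ^ 2 * ε ^ 2) p * ‖A.residual H x‖ ^ 2 := by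
  have heval (y : SymInterval) : ∑ m ∈ p.support, p.coeff m *
      (hermiteWeight ε τ 0 y * ((y : ℝ) - 0) ^ m) = hermiteWeight ε τ 0 y * p.eval (y : ℝ) := by
    rw [eval_eq_sum, sum_def, mul_sum, sub_zero]
    exact sum_congr rfl fun m _ => by ring
  have hdual := A.sq_sum_mul_le_mul_norm_residual_sq (hH.hasSum_kernel 0)
    (fun m => div_pos (pow_pos hl m) (by positivity)) (s := p.support) (b := p.coeff)
    (fun k => by rw [heval, hp, mul_zero]) x
  have hnorm : ∑ m ∈ p.support, p.coeff m ^ 2 / ((τ ^ 2 * ε ^ 2) ^ m / m.factorial) =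
      expNormSq (τ ^ 2 * ε ^ 2) p :=
    sum_congr rfl fun m _ => by rw [div_div_eq_mul_div, mul_comm, mul_div_right_comm]
  rw [heval, hnorm] at hdual
  calc p.eval (x : ℝ) ^ 2
      ≤ (Real.exp (ε ^ 2) * hermiteWeight ε τ 0 x ^ 2) * p.eval (x : ℝ) ^ 2 :=
        le_mul_of_one_le_left (sq_nonneg _) (one_le_exp_mul_sq_hermiteWeight_zero ε τ x)
    _ = Real.exp (ε ^ 2) * (hermiteWeight ε τ 0 x * p.eval (x : ℝ)) ^ 2 := by ring
    _ ≤ Real.exp (ε ^ 2) *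
          (expNormSq (τ ^ 2 * ε ^ 2) p * ‖A.residual H x‖ ^ 2) := by gcongr
    _ = _ := (mul_assoc _ _ _).symm

lemma LinearApprox.one_le_mul_sq_of_norm_residual_le (hl : 0 < τ ^ 2 * ε ^ 2)
    (hH : HasReproducingKernel H (analyticHermiteKernel ε τ)) (A : LinearApprox n) {E : ℝ}
    (hE : ∀ x, ‖A.residual H x‖ ≤ E) :
    1 ≤ 2 * (Real.exp (ε ^ 2) * E ^ 2) *
      ∑ k ∈ range (n + 1), expNormSq (τ ^ 2 * ε ^ 2) (Chebyshev.T ℝ k) := by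
  set v : Fin n → ℝ := fun k => A.node k
  set p := Lagrange.nodal univ v
  have hdeg : p.degree ≤ n := by simp [p, Lagrange.degree_nodal]
  have hpos : 0 < expNormSq (τ ^ 2 * ε ^ 2) p :=
    expNormSq_pos hl Lagrange.nodal_monic.ne_zero
  have hp (x : ℝ) (hx : |x| ≤ 1) :
      |p.eval x| ≤ √(Real.exp (ε ^ 2) * expNormSq (τ ^ 2 * ε ^ 2) p * E ^ 2) := by
    refine Real.abs_le_sqrt ((A.sq_eval_le_of_eval_node_eq_zero hl hH
      (fun k => Lagrange.eval_nodal_at_node (v := v) (mem_univ k)) ⟨x, abs_le.1 hx⟩).trans ?_)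
    gcongr
    exact hE _
  have hbound := expNormSq_le_of_abs_eval_le hl.le hdeg hp
  rw [Real.sq_sqrt (by positivity)] at hbound
  refine le_of_mul_le_mul_left ((mul_one _).trans_le (hbound.trans_eq ?_)) hpos
  ring

lemma sq_factorial_rpow_neg_half (n : ℕ) :
    ((n.factorial : ℝ) ^ (-(1 / 2) : ℝ)) ^ 2 = (n.factorial : ℝ)⁻¹ := by
  rw [← Real.rpow_natCast, ← Real.rpow_mul (by positivity)]
  norm_num [Real.rpow_neg_one]

lemma sq_hermiteC1 (ε τ : ℝ) :
    hermiteC1 ε τ ^ 2 =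
      2 / (1 + τ ^ 2 * ε ^ 2) * Real.exp (-((τ ^ 2 * ε ^ 2) ^ 2 / 16 + ε ^ 2)) := by
  rw [hermiteC1, mul_pow, Real.sq_sqrt (by positivity), ← Real.exp_nat_mul]
  congr 2
  push_cast
  ring

lemma LinearApprox.hermiteC1_mul_le_of_norm_residual_le (hl : 0 < τ ^ 2 * ε ^ 2)
    (hH : HasReproducingKernel H (analyticHermiteKernel ε τ)) (hn : 7 ≤ n)
    (hln : 5 * (τ ^ 2 * ε ^ 2) ≤ n) (h9 : 9 ≤ τ ^ 2 * ε ^ 2 * n) (A : LinearApprox n) {E : ℝ}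
    (hE0 : 0 ≤ E) (hE : ∀ x, ‖A.residual H x‖ ≤ E) :
    hermiteC1 ε τ * (τ * ε / 2) ^ n * (n.factorial : ℝ) ^ (-(1 / 2) : ℝ) ≤ E := by
  have hone := A.one_le_mul_sq_of_norm_residual_le hl hH hE
  have hT := sum_expNormSq_T_le hl hn hln h9
  have hC := sq_hermiteC1 ε τ
  set l := τ ^ 2 * ε ^ 2
  set R := 4 ^ n / 4 * (n.factorial / l ^ n) * ((1 + l) * Real.exp (l ^ 2 / 16))
  have hinv : (hermiteC1 ε τ * (τ * ε / 2) ^ n * (n.factorial : ℝ) ^ (-(1 / 2) : ℝ)) ^ 2 *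
      (2 * Real.exp (ε ^ 2) * R) = 1 := by
    have hpow : ((τ * ε / 2) ^ n) ^ 2 = l ^ n / 4 ^ n := by
      rw [← pow_mul, mul_comm n 2, pow_mul, ← div_pow]
      congr 1
      ring
    rw [mul_pow, mul_pow, hC, hpow, sq_factorial_rpow_neg_half, neg_add, Real.exp_add,
      Real.exp_neg, Real.exp_neg]
    simp only [R]
    field_simp
    norm_num
  refine le_of_abs_le (abs_le_of_sq_le_sq ?_ hE0)
  refine le_of_mul_le_mul_right ?_ (show 0 < 2 * Real.exp (ε ^ 2) * R by positivity)
  calc _ = 1 := hinv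
    _ ≤ 2 * (Real.exp (ε ^ 2) * E ^ 2) *
        ∑ k ∈ range (n + 1), expNormSq l (Chebyshev.T ℝ k) := hone
    _ ≤ 2 * (Real.exp (ε ^ 2) * E ^ 2) * R := by gcongr
    _ = _ := by ring

theorem hermiteC1_mul_le_worstCaseError (hl : 0 < τ ^ 2 * ε ^ 2)
    (hH : HasReproducingKernel H (analyticHermiteKernel ε τ)) (hn : 7 ≤ n)
    (hln : 5 * (τ ^ 2 * ε ^ 2) ≤ n) (h9 : 9 ≤ τ ^ 2 * ε ^ 2 * n) (A : LinearApprox n) :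
    ENNReal.ofReal (hermiteC1 ε τ * (τ * ε / 2) ^ n * (n.factorial : ℝ) ^ (-(1 / 2) : ℝ)) ≤
      worstCaseError H A := by
  rcases eq_or_ne (worstCaseError H A) ⊤ with htop | htop
  · rw [htop]
    exact le_top
  refine ENNReal.ofReal_le_of_le_toReal (A.hermiteC1_mul_le_of_norm_residual_le hl hH hn hln h9
    ENNReal.toReal_nonneg fun x => ?_)
  rw [← ENNReal.ofReal_le_iff_le_toReal htop, ofReal_norm,
    A.worstCaseError_eq_iSup_enorm_residual]
  exact le_iSup (fun x => ‖A.residual H x‖ₑ) x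

end LowerBound

section WeightedInterpolation

variable {ε τ : ℝ} {H : Type*} [NormedAddCommGroup H] [InnerProductSpace ℝ H] [CompleteSpace H]
  [RKHS ℝ H SymInterval ℝ] {n : ℕ} {node : Fin n → SymInterval}

/-- The Lagrange interpolant of `f / w` multiplied by `w`, where the weight
`w = hermiteWeight ε τ (γ * x)` has a centre that moves with the point of evaluation `x`. -/
noncomputable def weightedInterpolation (ε τ γ : ℝ) {n : ℕ} (node : Fin n → SymInterval)
    (hnode : Function.Injective node) : LinearApprox n where
  node := node
  node_injective := hnode
  weight k x := hermiteWeight ε τ (γ * x) x / hermiteWeight ε τ (γ * x) (node k) *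
    (Lagrange.basis univ (fun i => (node i : ℝ)) k).eval (x : ℝ)
  weight_measurable k := by
    refine (Continuous.measurable (Continuous.mul ?_
      ((Polynomial.continuous _).comp continuous_subtype_val))).nullMeasurable
    unfold hermiteWeight
    exact Continuous.div (by fun_prop) (by fun_prop) fun x => (Real.exp_pos _).ne'

lemma hasSum_norm_residual_weightedInterpolation_sq
    (hH : HasReproducingKernel H (analyticHermiteKernel ε τ)) (γ : ℝ)
    (hnode : Function.Injective node) (x : SymInterval) :
    HasSum (fun m : ℕ => (τ ^ 2 * ε ^ 2) ^ m / m.factorial * (hermiteWeight ε τ (γ * x) x *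
        (interpError univ (fun k => (node k : ℝ)) ((X - C (γ * x)) ^ m)).eval (x : ℝ)) ^ 2)
      (‖(weightedInterpolation ε τ γ node hnode).residual H x‖ ^ 2) := by
  refine ((weightedInterpolation ε τ γ node hnode).hasSum_norm_residual_sq
    (hH.hasSum_kernel (γ * x)) x).congr_fun fun m => ?_
  congr 2
  rw [eval_interpError, mul_sub, mul_sum]
  simp only [eval_pow, eval_sub, eval_X, eval_C, weightedInterpolation]
  congr 1
  refine sum_congr rfl fun k _ => ?_
  have : hermiteWeight ε τ (γ * x) (node k) ≠ 0 := (Real.exp_pos _).ne'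
  field_simp

lemma le_pow_div_factorial_mul_of_hasSum {l : ℝ} (hl : 0 ≤ l) (hn : 0 < n) {e h : ℕ → ℝ} {N S : ℝ}
    (he0 : ∀ m < n, e m = 0) (he : ∀ j, e (n + j) ≤ h j) (hh : ∀ j, 0 ≤ h j)
    (hS : HasSum (fun j => (l / n) ^ j * h j) S)
    (hN : HasSum (fun m : ℕ => l ^ m / m.factorial * e m) N) :
    N ≤ l ^ n / n.factorial * S := by
  have : (0 : ℝ) < n := by exact_mod_cast hn
  have htail : HasSum (fun j : ℕ => l ^ (j + n) / (j + n).factorial * e (j + n)) N := by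
    have h := (hasSum_nat_add_iff' n).2 hN
    rwa [sum_eq_zero fun m hm => by rw [he0 m (mem_range.1 hm), mul_zero], sub_zero] at h
  refine hasSum_le (fun j => ?_) htail (hS.mul_left _)
  have hfact : (n.factorial : ℝ) * (n : ℝ) ^ j ≤ (n + j).factorial := by
    exact_mod_cast (Nat.mul_le_mul_left _ (Nat.pow_le_pow_left n.le_succ j)).trans
      Nat.factorial_mul_pow_le_factorial
  rw [add_comm j n]
  calc l ^ (n + j) / (n + j).factorial * e (n + j)
      ≤ l ^ (n + j) / (n + j).factorial * h j := by
        gcongr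
        exact he j
    _ ≤ l ^ (n + j) / (n.factorial * (n : ℝ) ^ j) * h j := by
        gcongr
        exact hh j
    _ = _ := by
        rw [pow_add, div_pow]
        field_simp

lemma hermiteWeight_mul_self_sq_le_one (ε τ : ℝ) {γ : ℝ} (hγ : γ ≤ γ ^ 2 / 2) (x : ℝ) :
    hermiteWeight ε τ (γ * x) x ^ 2 ≤ 1 := by
  rw [hermiteWeight, ← Real.exp_nat_mul, Real.exp_le_one_iff]
  push_cast
  nlinarith [mul_nonneg (sq_nonneg (τ * ε * x)) (sub_nonneg.2 hγ), sq_nonneg (ε * x)]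

lemma norm_residual_weightedInterpolation_sq_le
    (hH : HasReproducingKernel H (analyticHermiteKernel ε τ)) {γ : ℝ} (hγ : γ ≤ γ ^ 2 / 2)
    (hn : 0 < n) (hnode : Function.Injective node) (x : SymInterval) {h : ℕ → ℝ} {S : ℝ}
    (hle : ∀ j, (interpError univ (fun k => (node k : ℝ))
      ((X - C (γ * x)) ^ (n + j))).eval (x : ℝ) ^ 2 ≤ h j)
    (hS : HasSum (fun j => (τ ^ 2 * ε ^ 2 / n) ^ j * h j) S) :
    ‖(weightedInterpolation ε τ γ node hnode).residual H x‖ ^ 2 ≤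
      (τ ^ 2 * ε ^ 2) ^ n / n.factorial * S := by
  refine le_pow_div_factorial_mul_of_hasSum (by positivity) hn (fun m hm => ?_) (fun j => ?_)
    (fun j => (sq_nonneg _).trans (hle j)) hS
    (hasSum_norm_residual_weightedInterpolation_sq hH γ hnode x)
  · have hv : Function.Injective fun k => (node k : ℝ) := Subtype.val_injective.comp hnode
    have hdeg : ((X - C (γ * (x : ℝ))) ^ m).degree < (#(univ : Finset (Fin n)) : WithBot ℕ) := by
      rw [degree_pow, degree_X_sub_C]
      simpa using hm
    rw [interpError_eq_zero_of_degree_lt hv.injOn hdeg, eval_zero, mul_zero, sq, mul_zero]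
  · rw [mul_pow]
    exact (mul_le_of_le_one_left (sq_nonneg _)
      (hermiteWeight_mul_self_sq_le_one ε τ hγ x)).trans (hle j)

-- With the centre `-x` every node `t` satisfies `|x - t| + |t + x| ≤ 2`.
lemma sq_eval_interpError_X_sub_C_neg_pow_le (hnode : Function.Injective node) (x : SymInterval)
    (j : ℕ) :
    (interpError univ (fun k => (node k : ℝ)) ((X - C (-1 * (x : ℝ))) ^ (n + j))).eval (x : ℝ) ^ 2
      ≤ 4 ^ n * (2 * ((j + 2).choose 2 : ℝ) * 4 ^ j) := by
  have hx : |(x : ℝ) - -1 * x| ≤ 2 := abs_le.2 ⟨by linarith [x.2.1], by linarith [x.2.2]⟩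
  have hdist (k : Fin n) : |(x : ℝ) - node k| + |(node k : ℝ) - -1 * x| ≤ 2 := by
    have hk := (node k).2
    rcases abs_cases ((x : ℝ) - node k) with h | h <;>
    rcases abs_cases ((node k : ℝ) - -1 * x) with h' | h' <;>
    linarith [x.2.1, x.2.2, hk.1, hk.2]
  have herr := abs_eval_interpError_X_sub_C_pow_le hx (s := univ)
    (Subtype.val_injective.comp hnode).injOn (fun k _ => hdist k) (n + j)
  rw [card_univ, Fintype.card_fin, add_assoc, Nat.add_sub_cancel_left] at herr
  have hchoose : ((j : ℝ) + 1) ^ 2 ≤ 2 * ((j + 2).choose 2 : ℝ) := by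
    rw [Nat.cast_choose_two]
    push_cast
    nlinarith [(Nat.cast_nonneg j : (0 : ℝ) ≤ j)]
  calc _ ≤ (2 ^ (n + j) * ((j + 1 : ℕ) : ℝ)) ^ 2 := by
        rw [← sq_abs]
        exact pow_le_pow_left₀ (abs_nonneg _) herr 2
    _ = 4 ^ n * (((j : ℝ) + 1) ^ 2 * 4 ^ j) := by
        rw [mul_pow, ← pow_mul, mul_comm (n + j) 2, pow_mul, pow_add]
        push_cast
        norm_num
        ring
    _ ≤ _ := by gcongr

theorem norm_residual_weightedInterpolation_neg_one_sq_le
    (hH : HasReproducingKernel H (analyticHermiteKernel ε τ)) (hn : 0 < n)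
    (hln : 5 * (τ ^ 2 * ε ^ 2) ≤ n) (hnode : Function.Injective node) (x : SymInterval) :
    ‖(weightedInterpolation ε τ (-1) node hnode).residual H x‖ ^ 2 ≤
      (τ ^ 2 * ε ^ 2) ^ n / n.factorial * (250 * 4 ^ n) := by
  have hn0 : (0 : ℝ) < n := by exact_mod_cast hn
  refine (norm_residual_weightedInterpolation_sq_le hH (by norm_num) hn hnode x
    (sq_eval_interpError_X_sub_C_neg_pow_le hnode x) (S := 4 ^ n *
      (2 * (1 / (1 - 4 * (τ ^ 2 * ε ^ 2 / n)) ^ (2 + 1)))) ?_).trans ?_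
  all_goals
    set y := 4 * (τ ^ 2 * ε ^ 2 / n) with hy
    have hy0 : 0 ≤ y := by positivity
    have hy1 : y ≤ 4 / 5 := by
      rw [hy, mul_div_assoc', div_le_div_iff₀ hn0 (by norm_num)]
      linarith
  · refine (((hasSum_choose_mul_geometric_of_norm_lt_one 2 (r := y) ?_).mul_left 2).mul_left
      (4 ^ n)).congr_fun fun j => ?_
    · rw [Real.norm_of_nonneg hy0]
      linarith
    · rw [hy, mul_pow]
      ring
  · have hcube : (1 / 5 : ℝ) ^ 3 ≤ (1 - y) ^ (2 + 1) := by
      gcongr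
      linarith
    rw [mul_comm 250]
    gcongr
    calc 2 * (1 / (1 - y) ^ (2 + 1)) ≤ 2 * (1 / (1 / 5) ^ 3) := by gcongr
      _ = 250 := by norm_num

lemma sq_eval_interpError_chebyshevNode_X_pow_le {l : ℝ} (hl : 0 < l) (hn : 0 < n)
    (hln : l ≤ 2 * n) (x : SymInterval) (j : ℕ) :
    (interpError univ (fun k => (chebyshevNode n k : ℝ)) (X ^ (n + j))).eval (x : ℝ) ^ 2 ≤
      16 * Real.exp l / 4 ^ n * (n / l * ((1 + l / (2 * n)) ^ 2 / 2)) ^ j := by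
  have hn0 : (0 : ℝ) < n := by exact_mod_cast hn
  have : Nonempty (Fin n) := Fin.pos_iff_nonempty.1 hn
  -- The bound below has ratio about `u ^ 2 / 4` in `j`, and the series for the residual multiplies
  -- it by `l / n`: this `u` makes the product about `1 / 2`.
  set u := √(2 * n / l)
  have hu : u ^ 2 = 2 * n / l := Real.sq_sqrt (by positivity)
  have hu0 : 0 < u := Real.sqrt_pos.2 (by positivity)
  have hu1 : 1 ≤ u := by
    rwa [Real.one_le_sqrt, le_div_iff₀ hl, one_mul]
  set y := l / (2 * n)
  have hmean : ((u + u⁻¹) / 2) ^ 2 = u ^ 2 * (1 + y) ^ 2 / 4 := by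
    rw [show y = (u ^ 2)⁻¹ by rw [hu, inv_div]]
    field_simp
    norm_num
  have hexp : (1 + y) ^ (2 * n) ≤ Real.exp l := by
    have := Real.one_sub_div_pow_le_exp_neg (n := 2 * n) (t := -l) (by push_cast; linarith)
    rwa [Nat.cast_mul, Nat.cast_two, neg_div, sub_neg_eq_add, neg_neg] at this
  have herr := abs_eval_interpError_X_pow_le univ_nonempty
    (Subtype.val_injective.comp (chebyshevNode_injective n)).injOn
    (fun k _ => by simpa using eval_T_chebyshevNode n k) (abs_le.2 x.2) hu1 (n + j)
  rw [card_univ, Fintype.card_fin] at herr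
  calc _ ≤ (4 * (u ^ n)⁻¹ * ((u + u⁻¹) / 2) ^ (n + j)) ^ 2 := by
        rw [← sq_abs]
        exact pow_le_pow_left₀ (abs_nonneg _) herr 2
    _ = 16 * ((u ^ 2) ^ n)⁻¹ * (((u + u⁻¹) / 2) ^ 2) ^ n * (((u + u⁻¹) / 2) ^ 2) ^ j := by
        rw [pow_add]
        simp only [← pow_mul, mul_comm 2, mul_pow, inv_pow]
        ring
    _ = 16 * (1 + y) ^ (2 * n) / 4 ^ n * (n / l * ((1 + y) ^ 2 / 2)) ^ j := by
        rw [hmean, div_pow, mul_pow, ← pow_mul (1 + y), hu]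
        congr 1
        · field_simp
        · congr 1
          ring
    _ ≤ _ := by gcongr

theorem norm_residual_weightedInterpolation_chebyshevNode_sq_le (hl : 0 < τ ^ 2 * ε ^ 2)
    (hH : HasReproducingKernel H (analyticHermiteKernel ε τ)) (hn : 0 < n)
    (hln : 5 * (τ ^ 2 * ε ^ 2) ≤ n) (x : SymInterval) :
    ‖(weightedInterpolation ε τ 0 _ (chebyshevNode_injective n)).residual H x‖ ^ 2 ≤
      (τ ^ 2 * ε ^ 2) ^ n / n.factorial * (64 * Real.exp (τ ^ 2 * ε ^ 2) / 4 ^ n) := by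
  have hn0 : (0 : ℝ) < n := by exact_mod_cast hn
  have hle (j : ℕ) := sq_eval_interpError_chebyshevNode_X_pow_le hl hn (by linarith) x j
  set l := τ ^ 2 * ε ^ 2
  have hy : l / (2 * n) ≤ 1 / 10 := by
    rw [div_le_iff₀ (by positivity)]
    linarith
  have hρ : (1 + l / (2 * n)) ^ 2 / 2 ≤ 3 / 4 := by
    calc (1 + l / (2 * n)) ^ 2 / 2 ≤ (1 + 1 / 10) ^ 2 / 2 := by gcongr
      _ ≤ 3 / 4 := by norm_num
  set ρ := (1 + l / (2 * n)) ^ 2 / 2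
  refine (norm_residual_weightedInterpolation_sq_le hH (γ := 0) (by norm_num) hn
    (chebyshevNode_injective n) x (by simpa using hle)
    (S := 16 * Real.exp l / 4 ^ n * (1 - ρ)⁻¹) ?_).trans ?_
  · refine ((hasSum_geometric_of_lt_one (by positivity) (by linarith)).mul_left _).congr_fun
      fun j => ?_
    rw [mul_left_comm, ← mul_pow, ← mul_assoc, div_mul_div_cancel₀ hn0.ne', div_self hl.ne',
      one_mul]
  · gcongr
    calc 16 * Real.exp l / 4 ^ n * (1 - ρ)⁻¹ ≤ 16 * Real.exp l / 4 ^ n * (1 - 3 / 4)⁻¹ := by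
          gcongr
      _ = _ := by ring

end WeightedInterpolation

section Constants

variable {l : ℝ} {n : ℕ}

lemma five_le_cL_factor (hl : 0 < l) :
    5 ≤ 3 + √(Real.pi / Real.exp 1) + 2 / (√Real.pi * l ^ (1 / 4 : ℝ)) + 7 / (16 * √l)
      + √l * (2 + l) := by
  have ht : 0 < √l := Real.sqrt_pos.2 hl
  have hpi : 1 ≤ √(Real.pi / Real.exp 1) := by
    rw [Real.one_le_sqrt, one_le_div (Real.exp_pos _)]
    linarith [Real.exp_one_lt_d9, Real.pi_gt_d2]
  have hquarter : 0 ≤ 2 / (√Real.pi * l ^ (1 / 4 : ℝ)) := by positivity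
  have hsqrt : 1 ≤ 7 / (16 * √l) + 2 * √l := by
    rw [div_add' _ _ _ (by positivity), one_le_div (by positivity)]
    nlinarith [sq_nonneg (√l - 1 / 4)]
  nlinarith [mul_pos ht hl]

lemma two_mul_sqrt_pi_le : 2 * √Real.pi ≤ 25 / 7 := by
  have : √Real.pi ≤ 25 / 14 := (Real.sqrt_le_left (by norm_num)).2 (by linarith [Real.pi_lt_d2])
  linarith

lemma le_exp_two_fifths_mul {s : ℝ} (hs : 0 ≤ s) : s ≤ Real.exp (2 / 5 * s) := by
  calc s ≤ Real.exp 1 * (2 / 5 * s) := by nlinarith [Real.exp_one_gt_d9]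
    _ ≤ Real.exp 1 * Real.exp (2 / 5 * s - 1) := by
        gcongr
        linarith [Real.add_one_le_exp (2 / 5 * s - 1)]
    _ = _ := by
        rw [← Real.exp_add]
        congr 1
        ring

lemma sqrt_le_exp_div_five {s : ℝ} (hs : 0 ≤ s) : √s ≤ Real.exp (s / 5) := by
  rw [Real.sqrt_le_left (Real.exp_pos _).le, ← Real.exp_nat_mul]
  convert le_exp_two_fifths_mul hs using 2
  push_cast
  ring

lemma cL_mul_eq (hl : 0 < l) (hn : 0 < n) :
    cL l * (n : ℝ) ^ (-(1 / 4) : ℝ) * Real.exp (2 * √(l * n)) =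
      Real.exp (2 * √(l * n) - 3 / 2 * l + 2 * √l) / (2 * √Real.pi * √√(l * n)) *
        (3 + √(Real.pi / Real.exp 1) + 2 / (√Real.pi * l ^ (1 / 4 : ℝ)) + 7 / (16 * √l)
          + √l * (2 + l)) := by
  have hn0 : (0 : ℝ) < n := by exact_mod_cast hn
  have hroot : √√(l * n) = l ^ (1 / 4 : ℝ) * (n : ℝ) ^ (1 / 4 : ℝ) := by
    rw [Real.sqrt_eq_rpow, Real.sqrt_eq_rpow, ← Real.rpow_mul (by positivity),
      Real.mul_rpow hl.le hn0.le]
    norm_num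
  have hexp : Real.exp (2 * √(l * n) - 3 / 2 * l + 2 * √l) =
      Real.exp (-(3 / 2) * l + 2 * √l) * Real.exp (2 * √(l * n)) := by
    rw [← Real.exp_add]
    congr 1
    ring
  rw [cL, hroot, hexp, Real.rpow_neg hn0.le]
  ring

lemma exp_le_cL_mul (hl : 0 < l) (hn : 0 < n) :
    7 / 5 * Real.exp (9 / 5 * √(l * n) - 3 / 2 * l + 2 * √l) ≤
      cL l * (n : ℝ) ^ (-(1 / 4) : ℝ) * Real.exp (2 * √(l * n)) := by
  rw [cL_mul_eq hl hn]
  set s := √(l * n)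
  have hs : 0 < s := Real.sqrt_pos.2 (by positivity)
  have hsplit : Real.exp (2 * s - 3 / 2 * l + 2 * √l) =
      Real.exp (9 / 5 * s - 3 / 2 * l + 2 * √l) * Real.exp (s / 5) := by
    rw [← Real.exp_add]
    congr 1
    ring
  calc 7 / 5 * Real.exp (9 / 5 * s - 3 / 2 * l + 2 * √l)
      = Real.exp (2 * s - 3 / 2 * l + 2 * √l) / (25 / 7 * Real.exp (s / 5)) * 5 := by
        rw [hsplit]
        field_simp
        norm_num
    _ ≤ _ := by
        have := Real.sqrt_pos.2 hs
        gcongr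
        · exact two_mul_sqrt_pi_le
        · exact sqrt_le_exp_div_five hs.le
        · exact five_le_cL_factor hl

lemma le_sqrt_mul_of_five_mul_le (hl : 0 ≤ l) (h5 : 5 * l ≤ n) : 11 / 5 * l ≤ √(l * n) := by
  refine Real.le_sqrt_of_sq_le ?_
  nlinarith

lemma three_le_sqrt_mul (h9 : 9 ≤ l * n) : 3 ≤ √(l * n) := by
  rw [Real.le_sqrt' (by norm_num)]
  linarith

lemma exponent_lower_bounds {s : ℝ} (hl : 0 ≤ l) (hs : 3 ≤ s) (hls : 11 / 5 * l ≤ s) :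
    27 / 5 ≤ 9 / 5 * s - 3 / 2 * l + 2 * √l ∧ l + 3 ≤ 9 / 5 * s - 3 / 2 * l + 2 * √l := by
  have ht := Real.sqrt_nonneg l
  have ht2 := Real.sq_sqrt hl
  rcases le_or_gt √l (4 / 3) with h | h <;> constructor <;> nlinarith

lemma two_hundred_fifty_le_cL_mul (hl : 0 < l) (hn : 0 < n) (h5 : 5 * l ≤ n) (h9 : 9 ≤ l * n) :
    250 ≤ cL l * (n : ℝ) ^ (-(1 / 4) : ℝ) * Real.exp (2 * √(l * n)) := by
  refine le_trans ?_ (exp_le_cL_mul hl hn)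
  have hexp : (2.7 : ℝ) ^ 5 * (2 / 5 + 1) ≤ Real.exp (27 / 5) := by
    rw [show (27 / 5 : ℝ) = ((5 : ℕ) : ℝ) * 1 + 2 / 5 by norm_num, Real.exp_add, Real.exp_nat_mul]
    gcongr
    · linarith [Real.exp_one_gt_d9]
    · exact Real.add_one_le_exp _
  calc (250 : ℝ) ≤ 7 / 5 * Real.exp (27 / 5) := by
        norm_num at hexp
        linarith
    _ ≤ _ := mul_le_mul_of_nonneg_left (Real.exp_le_exp.2 (exponent_lower_bounds hl.le
          (three_le_sqrt_mul h9) (le_sqrt_mul_of_five_mul_le hl.le h5)).1) (by norm_num)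

lemma sixteen_mul_exp_le_cL_mul (hl : 0 < l) (hn : 0 < n) (h5 : 5 * l ≤ n) (h9 : 9 ≤ l * n) :
    16 * Real.exp l ≤ cL l * (n : ℝ) ^ (-(1 / 4) : ℝ) * Real.exp (2 * √(l * n)) := by
  refine le_trans ?_ (exp_le_cL_mul hl hn)
  have hexp : (2.7 : ℝ) ^ 3 ≤ Real.exp 3 := by
    rw [show (3 : ℝ) = ((3 : ℕ) : ℝ) * 1 by norm_num, Real.exp_nat_mul]
    gcongr
    linarith [Real.exp_one_gt_d9]
  calc 16 * Real.exp l ≤ 7 / 5 * Real.exp (l + 3) := by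
        rw [Real.exp_add]
        norm_num at hexp
        nlinarith [Real.exp_pos l]
    _ ≤ _ := mul_le_mul_of_nonneg_left (Real.exp_le_exp.2 (exponent_lower_bounds hl.le
          (three_le_sqrt_mul h9) (le_sqrt_mul_of_five_mul_le hl.le h5)).2) (by norm_num)

lemma sq_mul_sqrt_cL_mul {ε τ : ℝ} (hετ : 0 ≤ τ * ε) (n : ℕ) (a b : ℝ) :
    (a * √(cL (τ ^ 2 * ε ^ 2)) * (n : ℝ) ^ (-(1 / 8) : ℝ) * Real.exp (τ * ε * √(n : ℝ)) *
      (b * (τ * ε)) ^ n * (n.factorial : ℝ) ^ (-(1 / 2) : ℝ)) ^ 2 =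
    (τ ^ 2 * ε ^ 2) ^ n / n.factorial * (a ^ 2 * (b ^ 2) ^ n * (cL (τ ^ 2 * ε ^ 2) *
      (n : ℝ) ^ (-(1 / 4) : ℝ) * Real.exp (2 * √(τ ^ 2 * ε ^ 2 * n)))) := by
  have hcL : 0 ≤ cL (τ ^ 2 * ε ^ 2) := by
    rw [cL]
    positivity
  have hn : ((n : ℝ) ^ (-(1 / 8) : ℝ)) ^ 2 = (n : ℝ) ^ (-(1 / 4) : ℝ) := by
    rw [← Real.rpow_natCast, ← Real.rpow_mul (by positivity)]
    norm_num
  have hsqrt : √(τ ^ 2 * ε ^ 2 * n) = τ * ε * √n := by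
    rw [Real.sqrt_mul (by positivity), ← mul_pow, Real.sqrt_sq hετ]
  have hpow : ((b * (τ * ε)) ^ n) ^ 2 = (b ^ 2) ^ n * (τ ^ 2 * ε ^ 2) ^ n := by
    rw [← pow_mul, mul_comm n 2, pow_mul, ← mul_pow]
    congr 1
    ring
  have hexp : Real.exp (τ * ε * √n) ^ 2 = Real.exp (2 * (τ * ε * √n)) := by
    rw [← Real.exp_nat_mul, Nat.cast_two]
  rw [mul_pow, mul_pow, mul_pow, mul_pow, mul_pow, Real.sq_sqrt hcL, hn, hsqrt, hpow, hexp,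
    sq_factorial_rpow_neg_half]
  ring

end Constants

section UpperBound

variable {ε τ : ℝ} {H : Type*} [NormedAddCommGroup H] [InnerProductSpace ℝ H] [CompleteSpace H]
  [RKHS ℝ H SymInterval ℝ] {n : ℕ}

lemma LinearApprox.worstCaseError_le_of_norm_residual_sq_le (A : LinearApprox n)
    (hετ : 0 ≤ τ * ε) {a b C : ℝ} (ha : 0 ≤ a) (hb : 0 ≤ b)
    (hA : ∀ x, ‖A.residual H x‖ ^ 2 ≤ (τ ^ 2 * ε ^ 2) ^ n / n.factorial * C)
    (hC : C ≤ a ^ 2 * (b ^ 2) ^ n * (cL (τ ^ 2 * ε ^ 2) * (n : ℝ) ^ (-(1 / 4) : ℝ) *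
      Real.exp (2 * √(τ ^ 2 * ε ^ 2 * n)))) :
    worstCaseError H A ≤ ENNReal.ofReal (a * √(cL (τ ^ 2 * ε ^ 2)) * (n : ℝ) ^ (-(1 / 8) : ℝ) *
      Real.exp (τ * ε * √(n : ℝ)) * (b * (τ * ε)) ^ n * (n.factorial : ℝ) ^ (-(1 / 2) : ℝ)) := by
  rw [A.worstCaseError_eq_iSup_enorm_residual]
  refine iSup_le fun x => ?_
  rw [← ofReal_norm]
  refine ENNReal.ofReal_le_ofReal (le_of_abs_le (abs_le_of_sq_le_sq ((hA x).trans ?_) ?_))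
  · rw [sq_mul_sqrt_cL_mul hετ]
    gcongr
  · positivity

theorem worstCaseError_weightedInterpolation_neg_one_le (hε : 0 < ε) (hτ : 0 < τ)
    (hH : HasReproducingKernel H (analyticHermiteKernel ε τ)) (hn : 0 < n)
    (h5 : 5 * (τ ^ 2 * ε ^ 2) ≤ n) (h9 : 9 ≤ τ ^ 2 * ε ^ 2 * n) {node : Fin n → SymInterval}
    (hnode : Function.Injective node) :
    worstCaseError H (weightedInterpolation ε τ (-1) node hnode) ≤ ENNReal.ofReal
      (hermiteC2 ε τ / 2 * (n : ℝ) ^ (-(1 / 8) : ℝ) * Real.exp (τ * ε * √(n : ℝ)) *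
        (2 * τ * ε) ^ n * (n.factorial : ℝ) ^ (-(1 / 2) : ℝ)) := by
  have hC : 250 * 4 ^ n ≤ (1 : ℝ) ^ 2 * (2 ^ 2) ^ n * (cL (τ ^ 2 * ε ^ 2) *
      (n : ℝ) ^ (-(1 / 4) : ℝ) * Real.exp (2 * √(τ ^ 2 * ε ^ 2 * n))) := by
    rw [one_pow, one_mul, mul_comm]
    gcongr
    · norm_num
    · exact two_hundred_fifty_le_cL_mul (by positivity) hn h5 h9
  have h := LinearApprox.worstCaseError_le_of_norm_residual_sq_le _ (by positivity) zero_le_one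
    zero_le_two (norm_residual_weightedInterpolation_neg_one_sq_le hH hn h5 hnode) hC
  rwa [one_mul, ← mul_assoc 2 τ ε, ← mul_div_cancel_left₀ √_ two_ne_zero, ← hermiteC2] at h

theorem worstCaseError_weightedInterpolation_chebyshevNode_le (hε : 0 < ε) (hτ : 0 < τ)
    (hH : HasReproducingKernel H (analyticHermiteKernel ε τ)) (hn : 0 < n)
    (h5 : 5 * (τ ^ 2 * ε ^ 2) ≤ n) (h9 : 9 ≤ τ ^ 2 * ε ^ 2 * n) :
    worstCaseError H (weightedInterpolation ε τ 0 _ (chebyshevNode_injective n)) ≤ ENNReal.ofReal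
      (hermiteC2 ε τ * (n : ℝ) ^ (-(1 / 8) : ℝ) * Real.exp (τ * ε * √(n : ℝ)) *
        (τ * ε / 2) ^ n * (n.factorial : ℝ) ^ (-(1 / 2) : ℝ)) := by
  have hl : 0 < τ ^ 2 * ε ^ 2 := by positivity
  have hC : 64 * Real.exp (τ ^ 2 * ε ^ 2) / 4 ^ n ≤ (2 : ℝ) ^ 2 * ((1 / 2) ^ 2) ^ n *
      (cL (τ ^ 2 * ε ^ 2) * (n : ℝ) ^ (-(1 / 4) : ℝ) *
        Real.exp (2 * √(τ ^ 2 * ε ^ 2 * n))) := by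
    calc 64 * Real.exp (τ ^ 2 * ε ^ 2) / 4 ^ n
        = (2 : ℝ) ^ 2 * ((1 / 2) ^ 2) ^ n * (16 * Real.exp (τ ^ 2 * ε ^ 2)) := by
          rw [show ((1 / 2 : ℝ) ^ 2) = 1 / 4 by norm_num, one_div_pow]
          ring
      _ ≤ _ := mul_le_mul_of_nonneg_left (sixteen_mul_exp_le_cL_mul hl hn h5 h9) (by positivity)
  have h := LinearApprox.worstCaseError_le_of_norm_residual_sq_le _ (by positivity) zero_le_two
    one_half_pos.le (norm_residual_weightedInterpolation_chebyshevNode_sq_le hl hH hn h5) hC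
  rwa [one_div_mul_eq_div, ← hermiteC2] at h

end UpperBound

theorem mainTheorem8_general (ε τ : ℝ) (hε : 0 < ε) (hτ : 0 < τ)
    (H : Type*) [NormedAddCommGroup H] [InnerProductSpace ℝ H] [CompleteSpace H]
    [RKHS ℝ H SymInterval ℝ] (hH : HasReproducingKernel H (analyticHermiteKernel ε τ))
    (n : ℕ) (h5 : 5 * (τ ^ 2 * ε ^ 2) ≤ (n : ℝ))
    (h9 : 9 / (τ ^ 2 * ε ^ 2) ≤ (n : ℝ)) :
    (∀ x y : SymInterval, analyticHermiteKernel ε τ x y =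
      weightedPowerSeriesKernel (fun k => ((τ * ε) ^ (2 * k))⁻¹ * (k.factorial : ℝ))
        (fun x => Real.exp (-(1 / 2) * ε ^ 2 * (x : ℝ) ^ 2)) x y) ∧
    (ENNReal.ofReal
        (hermiteC1 ε τ * (τ * ε / 2) ^ n * (n.factorial : ℝ) ^ (-(1 / 2) : ℝ)) ≤
      minimalError H n ∧
    minimalError H n ≤ ENNReal.ofReal
        (hermiteC2 ε τ * (n : ℝ) ^ (-(1 / 8) : ℝ) * Real.exp (τ * ε * √(n : ℝ)) *
          (τ * ε / 2) ^ n * (n.factorial : ℝ) ^ (-(1 / 2) : ℝ))) ∧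
    (∀ x : Fin n → SymInterval, Function.Injective x →
      ∃ A : LinearApprox n, A.node = x ∧
        ENNReal.ofReal
            (hermiteC1 ε τ * (τ * ε / 2) ^ n * (n.factorial : ℝ) ^ (-(1 / 2) : ℝ)) ≤
          worstCaseError H A ∧
        worstCaseError H A ≤ ENNReal.ofReal
            (hermiteC2 ε τ / 2 * (n : ℝ) ^ (-(1 / 8) : ℝ) * Real.exp (τ * ε * √(n : ℝ)) *
              (2 * τ * ε) ^ n * (n.factorial : ℝ) ^ (-(1 / 2) : ℝ))) := by
  have hl : 0 < τ ^ 2 * ε ^ 2 := by positivity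
  replace h9 : 9 ≤ τ ^ 2 * ε ^ 2 * n := (div_le_iff₀' hl).1 h9
  have hn : 7 ≤ n := by
    have h6 : (6 : ℝ) < n := by
      by_contra! h
      nlinarith
    exact_mod_cast h6
  have hlower (A : LinearApprox n) := hermiteC1_mul_le_worstCaseError hl hH hn h5 h9 A
  have hn0 : 0 < n := Nat.zero_lt_of_lt hn
  refine ⟨analyticHermiteKernel_eq_weightedPowerSeriesKernel ε τ, ⟨le_iInf hlower, ?_⟩,
    fun x hx => ⟨weightedInterpolation ε τ (-1) x hx, rfl, hlower _, ?_⟩⟩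
  · exact iInf_le_of_le _ (worstCaseError_weightedInterpolation_chebyshevNode_le hε hτ hH hn0 h5 h9)
  · exact worstCaseError_weightedInterpolation_neg_one_le hε hτ hH hn0 h5 h9 hx

theorem mainTheorem8 (ε τ : ℝ) (hε : 0 < ε) (hτ : 0 < τ)
    (H : Type*) [NormedAddCommGroup H] [InnerProductSpace ℝ H] [CompleteSpace H]
    [RKHS ℝ H SymInterval ℝ] (hH : HasReproducingKernel H (analyticHermiteKernel ε τ))
    (n : ℕ) (hn : mL (τ ^ 2 * ε ^ 2) ≤ (n : ℝ)) :
    -- the kernel is the weighted power series kernel of `αₖ` and `φ`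
    (∀ x y : SymInterval, analyticHermiteKernel ε τ x y =
      weightedPowerSeriesKernel (fun k => ((τ * ε) ^ (2 * k))⁻¹ * (k.factorial : ℝ))
        (fun x => Real.exp (-(1 / 2) * ε ^ 2 * (x : ℝ) ^ 2)) x y) ∧
    -- the `n`th minimal error
    (ENNReal.ofReal
        (hermiteC1 ε τ * (τ * ε / 2) ^ n * (n.factorial : ℝ) ^ (-(1 / 2) : ℝ)) ≤
      minimalError H n ∧
    minimalError H n ≤ ENNReal.ofReal
        (hermiteC2 ε τ * (n : ℝ) ^ (-(1 / 8) : ℝ) * Real.exp (τ * ε * √(n : ℝ)) *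
          (τ * ε / 2) ^ n * (n.factorial : ℝ) ^ (-(1 / 2) : ℝ))) ∧
    -- approximation at arbitrary points
    (∀ x : Fin n → SymInterval, Function.Injective x →
      ∃ A : LinearApprox n, A.node = x ∧
        ENNReal.ofReal
            (hermiteC1 ε τ * (τ * ε / 2) ^ n * (n.factorial : ℝ) ^ (-(1 / 2) : ℝ)) ≤
          worstCaseError H A ∧
        worstCaseError H A ≤ ENNReal.ofReal
            (hermiteC2 ε τ / 2 * (n : ℝ) ^ (-(1 / 8) : ℝ) * Real.exp (τ * ε * √(n : ℝ)) *
              (2 * τ * ε) ^ n * (n.factorial : ℝ) ^ (-(1 / 2) : ℝ))) :=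
  mainTheorem8_general ε τ hε hτ H hH n ((le_max_left _ _).trans hn)
    (((le_max_right _ _).trans (le_max_right _ _)).trans hn)
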